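/- **Setting.** Let $\mathbb F$ be a field of characteristic $0$ and $r\ge 1$ an integer. Algebras and vector spaces are over $\mathbb F$, associative algebras are unital, and modules are right modules. *Data.* Let $\Gamma$ be an abelian group, $L$ a subgroup of $\Gamma$, and $(\mathcal A,-)$ an associative $L$-torus with involution: $\mathcal A=\bigoplus_{\sigma\in L}\mathcal A^\sigma$ is a nonzero graded algebra, each $\mathcal A^\sigma$ ($\sigma\in L$) is spanned by an invertible element, and $-$ is an $\mathbb F$-linear anti-automorphism with $\bar{\bar\alpha}=\alpha$ that preserves the grading. Put $\mathcal A^\sigma=0$ for $\sigma\in\Gamma\setminus L$. Let $X=\bigoplus_{\sigma\in\Gamma}X^\sigma$ be a $\Gamma$-graded $\mathcal A$-module and $\xi:X\times X\to\mathcal A$ a nondegenerate $\Gamma$-graded hermitian form: $\xi$ is bi-additive, $\xi(x.\alpha,y)=\bar\alpha\,\xi(x,y)$, $\xi(x,y.\alpha)=\xi(x,y)\alpha$, $\xi(y,x)=\overline{\xi(x,y)}$, and $\xi(X^\sigma,X^\tau)\subseteq\mathcal A^{\sigma+\tau}$. A *Witt decomposition* of $\xi$ is an orthogonal direct decomposition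 $X=X_{hyp}\perp X_{an}$ into graded $\mathcal A$-submodules such that $\xi$ is nondegenerate on $X_{hyp}$, $X_{hyp}=W_1\oplus W_2$ with $W_1,W_2$ totally isotropic graded submodules, and $\xi(x,x)\neq0$ for every nonzero homogeneous $x\in X_{an}$; the *Witt index* of $\xi$ is the common rank over $\mathcal A$ (cardinality of a homogeneous basis) of $W_1$ and $W_2$. Assume that $\dim_{\mathbb F}X^\sigma<\infty$ for all $\sigma$; that $\xi$ has Witt index $r$; that for some Witt decomposition $\{\sigma: X_{hyp}\cap X^\sigma\ne0\}=L$, there is $v\in X_{an}\cap X^0$ with $\xi(v,v)=1$, and $\dim_{\mathbb F}(X_{an}\cap X^\sigma)\le1$ for all $\sigma$; and that $\{\sigma: X^\sigma\neq0\}$ generates $\Gamma$. *Construction.* Choose a *compatible basis* for $\xi$: a homogeneous $\mathcal A$-basis $\{x_i\}_{i\in I}$ of $X$, $I=J\sqcup K$, $J=\{1,\dots,2r\}$, such that, with $\bar\imath=2r+1-i$ for $i\in J$ and $\bar\imath=i$ for $i\in K$, one has $\xi(x_i,x_j)=\delta_{i\bar\jmath}\gamma_i$ with $\gamma_i\ne0$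 homogeneous, $\gamma_i=1$ and $x_i\in X^0$ for $i\in J\cup\{k_0\}$ for some $k_0\in K$, and $X=\big(\bigoplus_{i\in J}x_i.\mathcal A\big)\perp\big(\bigoplus_{i\in K}x_i.\mathcal A\big)$ is a Witt decomposition. For $x,y\in X$ let $U(x,y)\in\mathrm{End}_{\mathcal A}(X)$, $U(x,y)z=x.\xi(y,z)-y.\xi(x,z)$. Let $\mathcal F=\mathrm{span}_{\mathbb F}\{U(x,y)\}$, a Lie algebra under the commutator, and $\mathcal S=[\mathcal F,\mathcal F]$. Let $h_i=U(x_i,x_{\bar\imath})$ for $1\le i\le r$, let $\varepsilon_1,\dots,\varepsilon_r$ be the basis dual to $h_1,\dots,h_r$, $Q=\mathbb Z\varepsilon_1\oplus\dots\oplus\mathbb Z\varepsilon_r$, and for $\mu\in Q$ let $X_\mu=\{x\in X: h_ix=\mu(h_i)x,\ 1\le i\le r\}$ and $X_\mu^\sigma=X_\mu\cap X^\sigma$. Then $\mathcal F$ and $\mathcal S$ are $(Q\times\Gamma)$-graded by $$\mathcal F_\nu^\tau=\sum_{\rho+\sigma=\tau}\ \sum_{\lambda+\mu=\nu}\mathrm{span}_{\mathbb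 F}\,U(X_\lambda^\rho,X_\mu^\sigma),\qquad \mathcal S_\nu^\tau=\mathcal S\cap\mathcal F_\nu^\tau .$$ $\mathcal S$ is the unitary Lie $\Gamma$-torus constructed from $\xi$. A $(Q\times\Gamma)$-graded Lie algebra $\mathcal L$ and a $(Q'\times\Gamma')$-graded Lie algebra $\mathcal L'$ are *bi-isomorphic* if there are an $\mathbb F$-Lie algebra isomorphism $\psi:\mathcal L\to\mathcal L'$ and group isomorphisms $\psi_{r}:Q\to Q'$, $\psi_{e}:\Gamma\to\Gamma'$ with $\psi(\mathcal L_\mu^\sigma)={\mathcal L'}_{\psi_r(\mu)}^{\psi_e(\sigma)}$ for all $\mu,\sigma$. **Theorem (Bi-isomorphism theorem).** Let $\Gamma,L,(\mathcal A,-),\xi:X\times X\to\mathcal A$ and $\Gamma',L',(\mathcal A',-),\xi':X'\times X'\to\mathcal A'$ be two sets of data as above, with the same $\mathbb F$ and $r$, and let $\mathcal F,\mathcal S$ and $\mathcal F',\mathcal S'$ be the graded Lie algebras constructed from them using any compatible bases for $\xi$ and $\xi'$. (a) Suppose there is a triple $(\theta,\theta_1,\theta_2)$, where $\theta:X\to X'$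 is an $\mathbb F$-linear isomorphism, $\theta_1:(\mathcal A,-)\to(\mathcal A',-)$ is an isomorphism of algebras with involution, and $\theta_2:\Gamma\to\Gamma'$ is a group isomorphism, such that $$\theta(x.\alpha)=\theta(x).\theta_1(\alpha),\quad \theta_1(\xi(x,y))=\xi'(\theta(x),\theta(y)),\quad \theta_1(\mathcal A^\sigma)={\mathcal A'}^{\theta_2(\sigma)},\quad \theta(X^\sigma)={X'}^{\theta_2(\sigma)}$$ for all $x,y\in X$, $\alpha\in\mathcal A$, $\sigma\in\Gamma$. Then $\theta_2(L)=L'$, $\mathcal F$ is bi-isomorphic to $\mathcal F'$, and $\mathcal S$ is bi-isomorphic to $\mathcal S'$. (b) Conversely, if $r\ge3$ and $\mathcal S$ and $\mathcal S'$ are bi-isomorphic, then there is a triple $(\theta,\theta_1,\theta_2)$ of maps with the properties in (a). -/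

import Mathlib

/-! An associative algebra is a Lie algebra under the commutator. -/
attribute [local instance] LieRing.ofAssociativeRing

noncomputable section

namespace UnitaryLieTorus

/-! Right modules over `A` are modules over `Aᵐᵒᵖ`: `x.a` is `MulOpposite.op a • x`. -/

/-! ### Hermitian forms and the finite and special unitary Lie algebras -/

section Hermitian

/-- A hermitian form over an algebra with involution `(A, star)` on a right `A`-module `X`. -/
structure HermitianForm (A X : Type*) [Ring A] [StarRing A] [AddCommGroup X]
    [Module Aᵐᵒᵖ X] where
  /-- The values of the form. -/
  toFun : X → X → A
  add_left : ∀ x y z, toFun (x + y) z = toFun x z + toFun y z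
  add_right : ∀ x y z, toFun x (y + z) = toFun x y + toFun x z
  smul_left : ∀ (a : A) (x y : X), toFun (MulOpposite.op a • x) y = star a * toFun x y
  smul_right : ∀ (a : A) (x y : X), toFun x (MulOpposite.op a • y) = toFun x y * a
  symm : ∀ x y, toFun y x = star (toFun x y)

variable {A X : Type*} [Ring A] [StarRing A] [AddCommGroup X] [Module Aᵐᵒᵖ X]

instance : CoeFun (HermitianForm A X) (fun _ => X → X → A) := ⟨HermitianForm.toFun⟩

namespace HermitianForm

/-- `ξ` is nondegenerate: `X^⊥ = 0`. -/
def Nondegenerate (ξ : HermitianForm A X) : Prop :=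
  ∀ x, (∀ y, ξ x y = 0) → x = 0

/-- The endomorphism `E(x, y) : z ↦ x.ξ(y, z)`. -/
def E (ξ : HermitianForm A X) (x y : X) : Module.End Aᵐᵒᵖ X where
  toFun z := MulOpposite.op (ξ y z) • x
  map_add' z w := by rw [ξ.add_right, MulOpposite.op_add, add_smul]
  map_smul' c z := by
    induction c using MulOpposite.rec' with
    | h a => rw [ξ.smul_right, MulOpposite.op_mul, mul_smul, RingHom.id_apply]

/-- `U(x, y) = E(x, y) - E(y, x)`. -/
def U (ξ : HermitianForm A X) (x y : X) : Module.End Aᵐᵒᵖ X := ξ.E x y - ξ.E y x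

theorem E_apply (ξ : HermitianForm A X) (x y z : X) :
    ξ.E x y z = MulOpposite.op (ξ y z) • x := rfl

theorem U_apply (ξ : HermitianForm A X) (x y z : X) :
    ξ.U x y z = MulOpposite.op (ξ y z) • x - MulOpposite.op (ξ x z) • y := rfl

theorem sub_left (ξ : HermitianForm A X) (x y z : X) : ξ (x - y) z = ξ x z - ξ y z := by
  rw [eq_sub_iff_add_eq, ← ξ.add_left, sub_add_cancel]

theorem sub_right (ξ : HermitianForm A X) (x y z : X) : ξ x (y - z) = ξ x y - ξ x z := by
  rw [eq_sub_iff_add_eq, ← ξ.add_right, sub_add_cancel]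

theorem U_skew (ξ : HermitianForm A X) (x y z w : X) :
    ξ (ξ.U x y z) w = - ξ z (ξ.U x y w) := by
  rw [U_apply, U_apply, sub_left, sub_right, smul_left, smul_left, smul_right, smul_right,
    ← ξ.symm, ← ξ.symm, neg_sub]

theorem lie_U (ξ : HermitianForm A X) (a b x y : X) :
    ⁅ξ.U a b, ξ.U x y⁆ = ξ.U (ξ.U a b x) y + ξ.U x (ξ.U a b y) := by
  rw [Ring.lie_def]
  ext z
  rw [LinearMap.sub_apply, Module.End.mul_apply, Module.End.mul_apply, LinearMap.add_apply,
    ξ.U_apply x y z, ξ.U_apply x y, ξ.U_apply _ y z, ξ.U_apply x _ z, map_sub, map_smul,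
    map_smul, U_skew, U_skew, MulOpposite.op_neg, MulOpposite.op_neg, neg_smul, neg_smul]
  abel

variable (F : Type*) [Field F] [Algebra F A] [Module F X] [IsScalarTower F Aᵐᵒᵖ X]

/-- The finite unitary Lie algebra: the `F`-span of all `U(x, y)` in the Lie algebra of
`A`-endomorphisms of `X`. -/
def finiteUnitary (ξ : HermitianForm A X) : LieSubalgebra F (Module.End Aᵐᵒᵖ X) where
  toSubmodule := Submodule.span F {T | ∃ x y, T = ξ.U x y}
  lie_mem' := by
    intro S T hS hT
    change ⁅S, T⁆ ∈ Submodule.span F {T | ∃ x y, T = ξ.U x y}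
    change S ∈ Submodule.span F {T | ∃ x y, T = ξ.U x y} at hS
    change T ∈ Submodule.span F {T | ∃ x y, T = ξ.U x y} at hT
    induction hS using Submodule.span_induction with
    | zero => rw [zero_lie]; exact Submodule.zero_mem _
    | add S₁ S₂ _ _ h₁ h₂ => rw [add_lie]; exact Submodule.add_mem _ h₁ h₂
    | smul c S₁ _ h => rw [smul_lie]; exact Submodule.smul_mem _ c h
    | mem S hS =>
      obtain ⟨a, b, rfl⟩ := hS
      induction hT using Submodule.span_induction with
      | zero => rw [lie_zero]; exact Submodule.zero_mem _
      | add S₁ S₂ _ _ h₁ h₂ => rw [lie_add]; exact Submodule.add_mem _ h₁ h₂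
      | smul c S₁ _ h => rw [lie_smul]; exact Submodule.smul_mem _ c h
      | mem T hT =>
        obtain ⟨x, y, rfl⟩ := hT
        rw [lie_U]
        exact Submodule.add_mem _ (Submodule.subset_span ⟨_, _, rfl⟩)
          (Submodule.subset_span ⟨_, _, rfl⟩)

theorem span_lie_le (ξ : HermitianForm A X) :
    Submodule.span F {T | ∃ S₁ ∈ ξ.finiteUnitary F, ∃ S₂ ∈ ξ.finiteUnitary F, T = ⁅S₁, S₂⁆} ≤
      (ξ.finiteUnitary F).toSubmodule := by
  rw [Submodule.span_le]
  rintro _ ⟨S₁, h₁, S₂, h₂, rfl⟩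
  exact (ξ.finiteUnitary F).lie_mem h₁ h₂

/-- The special unitary Lie algebra: the derived algebra of the finite unitary Lie algebra. -/
def specialUnitary (ξ : HermitianForm A X) : LieSubalgebra F (Module.End Aᵐᵒᵖ X) where
  toSubmodule := Submodule.span F
    {T | ∃ S₁ ∈ ξ.finiteUnitary F, ∃ S₂ ∈ ξ.finiteUnitary F, T = ⁅S₁, S₂⁆}
  lie_mem' := fun hS hT =>
    Submodule.subset_span ⟨_, ξ.span_lie_le F hS, _, ξ.span_lie_le F hT, rfl⟩

end HermitianForm

end Hermitian

/-! ### Gradings, associative tori with involution, Witt decompositions -/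

section Graded

variable {F Γ A X : Type*} [Field F] [AddCommGroup Γ] [Ring A] [StarRing A] [Algebra F A]
  [AddCommGroup X] [Module F X] [Module Aᵐᵒᵖ X]

open Classical in
/-- `(A, star)` is an associative `L`-torus with involution, regarded as a `Γ`-graded algebra
with involution by setting `A^σ = 0` for `σ ∉ L`. The involution is `F`-linear. -/
structure IsTorusWithInvolution (L : AddSubgroup Γ) (𝒜 : Γ → Submodule F A) : Prop where
  nontrivial : Nontrivial A
  star_smul : ∀ (c : F) (a : A), star (c • a) = c • star a
  isInternal : DirectSum.IsInternal 𝒜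
  mul_mem : ∀ {σ τ : Γ} {a b : A}, a ∈ 𝒜 σ → b ∈ 𝒜 τ → a * b ∈ 𝒜 (σ + τ)
  star_mem : ∀ {σ : Γ} {a : A}, a ∈ 𝒜 σ → star a ∈ 𝒜 σ
  exists_unit : ∀ σ ∈ L, ∃ u : A, IsUnit u ∧ 𝒜 σ = Submodule.span F {u}
  eq_bot : ∀ σ ∉ L, 𝒜 σ = ⊥

open Classical in
/-- `ξ` is a `Γ`-graded hermitian form (and `X` is a `Γ`-graded right `A`-module). -/
structure IsGradedForm (𝒜 : Γ → Submodule F A) (𝒳 : Γ → Submodule F X)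
    (ξ : HermitianForm A X) : Prop where
  isInternal : DirectSum.IsInternal 𝒳
  smul_mem : ∀ {σ τ : Γ} {x : X} {a : A}, x ∈ 𝒳 σ → a ∈ 𝒜 τ →
    MulOpposite.op a • x ∈ 𝒳 (σ + τ)
  form_mem : ∀ {σ τ : Γ} {x y : X}, x ∈ 𝒳 σ → y ∈ 𝒳 τ → ξ x y ∈ 𝒜 (σ + τ)

/-- `x` is homogeneous. -/
def IsHomog (𝒳 : Γ → Submodule F X) (x : X) : Prop := ∃ σ, x ∈ 𝒳 σ

/-- The `A`-submodule `W` is graded: each of its elements is a sum of homogeneous elements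
of `W`. -/
def IsGradedSubmodule (𝒳 : Γ → Submodule F X) (W : Submodule Aᵐᵒᵖ X) : Prop :=
  ∀ x ∈ W, x ∈ AddSubgroup.closure {y | y ∈ W ∧ IsHomog 𝒳 y}

/-- The support in `Γ` of an `A`-submodule `W`. -/
def supp (𝒳 : Γ → Submodule F X) (W : Submodule Aᵐᵒᵖ X) : Set Γ :=
  {σ | ∃ x ∈ W, x ∈ 𝒳 σ ∧ x ≠ 0}

/-- `H` is the direct sum of the totally isotropic graded submodules `W₁` and `W₂`. -/
structure IsIsotropicSplitting (𝒳 : Γ → Submodule F X) (ξ : HermitianForm A X)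
    (H W₁ W₂ : Submodule Aᵐᵒᵖ X) : Prop where
  graded₁ : IsGradedSubmodule 𝒳 W₁
  graded₂ : IsGradedSubmodule 𝒳 W₂
  isotropic₁ : ∀ x ∈ W₁, ∀ y ∈ W₁, ξ x y = 0
  isotropic₂ : ∀ x ∈ W₂, ∀ y ∈ W₂, ξ x y = 0
  disjoint : Disjoint W₁ W₂
  sup_eq : W₁ ⊔ W₂ = H

/-- The restriction of `ξ` to the submodule `H` is hyperbolic. -/
def IsHyperbolic (𝒳 : Γ → Submodule F X) (ξ : HermitianForm A X)
    (H : Submodule Aᵐᵒᵖ X) : Prop :=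
  (∀ x ∈ H, (∀ y ∈ H, ξ x y = 0) → x = 0) ∧ ∃ W₁ W₂, IsIsotropicSplitting 𝒳 ξ H W₁ W₂

/-- The restriction of `ξ` to the submodule `N` is anisotropic (in the graded sense). -/
def IsAnisotropic (𝒳 : Γ → Submodule F X) (ξ : HermitianForm A X)
    (N : Submodule Aᵐᵒᵖ X) : Prop :=
  ∀ x ∈ N, IsHomog 𝒳 x → x ≠ 0 → ξ x x ≠ 0

/-- `X = H ⊥ N` is a Witt decomposition of `ξ` (`H` is the hyperbolic and `N` the anisotropic
part). -/
structure IsWittDecomposition (𝒳 : Γ → Submodule F X) (ξ : HermitianForm A X)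
    (H N : Submodule Aᵐᵒᵖ X) : Prop where
  graded_hyp : IsGradedSubmodule 𝒳 H
  graded_an : IsGradedSubmodule 𝒳 N
  isCompl : IsCompl H N
  orthogonal : ∀ x ∈ H, ∀ y ∈ N, ξ x y = 0
  hyperbolic : IsHyperbolic 𝒳 ξ H
  anisotropic : IsAnisotropic 𝒳 ξ N

/-- The graded `A`-module `W` has rank `n`: it has a homogeneous `A`-basis with `n` elements. -/
def HasRank (𝒳 : Γ → Submodule F X) (W : Submodule Aᵐᵒᵖ X) (n : ℕ) : Prop :=
  ∃ b : Module.Basis (Fin n) Aᵐᵒᵖ W, ∀ i, IsHomog 𝒳 (b i : X)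

/-- `ξ` has Witt index `r`: the two totally isotropic summands of the hyperbolic part of a
Witt decomposition have rank `r`. -/
def HasWittIndex (𝒳 : Γ → Submodule F X) (ξ : HermitianForm A X) (r : ℕ) : Prop :=
  ∃ H N W₁ W₂, IsWittDecomposition 𝒳 ξ H N ∧ IsIsotropicSplitting 𝒳 ξ H W₁ W₂ ∧
    HasRank 𝒳 W₁ r ∧ HasRank 𝒳 W₂ r

variable [IsScalarTower F Aᵐᵒᵖ X]

/-- The data from which a unitary Lie `Γ`-torus of type `BC_r` is constructed. -/
structure IsUnitaryTorusData (r : ℕ) (L : AddSubgroup Γ) (𝒜 : Γ → Submodule F A)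
    (𝒳 : Γ → Submodule F X) (ξ : HermitianForm A X) : Prop where
  one_le : 1 ≤ r
  torus : IsTorusWithInvolution L 𝒜
  graded : IsGradedForm 𝒜 𝒳 ξ
  nondegenerate : ξ.Nondegenerate
  finite_dim : ∀ σ, FiniteDimensional F (𝒳 σ)
  witt_index : HasWittIndex 𝒳 ξ r
  /-- For some Witt decomposition `X = H ⊥ N`: the support of `H` is `L`, the form represents
  `1` on `N^0`, and `N` is finely graded. -/
  witt_decomposition : ∃ H N, IsWittDecomposition 𝒳 ξ H N ∧ supp 𝒳 H = (L : Set Γ) ∧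
    (∃ v ∈ N, v ∈ 𝒳 0 ∧ ξ v v = 1) ∧
    (∀ σ, Module.rank F ↥(N.restrictScalars F ⊓ 𝒳 σ) ≤ 1)
  full_support : AddSubgroup.closure {σ | 𝒳 σ ≠ ⊥} = ⊤

/-- A compatible `A`-basis `{x_i}` for `ξ`, indexed by the disjoint union of `J = {1, …, 2r}`
(here `Fin (2 * r)`, where `Fin.rev` is `i ↦ 2r + 1 - i`) and a set `K`. -/
structure IsCompatibleBasis {r : ℕ} {K : Type*} (𝒜 : Γ → Submodule F A)
    (𝒳 : Γ → Submodule F X) (ξ : HermitianForm A X)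
    (b : Module.Basis (Fin (2 * r) ⊕ K) Aᵐᵒᵖ X) : Prop where
  witt : IsWittDecomposition 𝒳 ξ
    (Submodule.span Aᵐᵒᵖ (Set.range fun j : Fin (2 * r) => b (Sum.inl j)))
    (Submodule.span Aᵐᵒᵖ (Set.range fun k : K => b (Sum.inr k)))
  deg_hyp : ∀ j : Fin (2 * r), b (Sum.inl j) ∈ 𝒳 0
  homog : ∀ k : K, IsHomog 𝒳 (b (Sum.inr k))
  form_hyp : ∀ i j : Fin (2 * r),
    ξ (b (Sum.inl i)) (b (Sum.inl j)) = if i = j.rev then 1 else 0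
  form_an_of_ne : ∀ k l : K, k ≠ l → ξ (b (Sum.inr k)) (b (Sum.inr l)) = 0
  form_an_self : ∀ k : K, ξ (b (Sum.inr k)) (b (Sum.inr k)) ≠ 0 ∧
    IsHomog 𝒜 (ξ (b (Sum.inr k)) (b (Sum.inr k)))
  exists_one : ∃ k : K, b (Sum.inr k) ∈ 𝒳 0 ∧ ξ (b (Sum.inr k)) (b (Sum.inr k)) = 1

/-! ### The gradings by the root lattice and by `Γ` -/

/-- The element `h_i = U(x_i, x_{2r+1-i})`, `1 ≤ i ≤ r`, of the ad-diagonalizable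
subalgebra. -/
def cartan {r : ℕ} {K : Type*} (ξ : HermitianForm A X)
    (b : Module.Basis (Fin (2 * r) ⊕ K) Aᵐᵒᵖ X) (i : Fin r) : Module.End Aᵐᵒᵖ X :=
  ξ.U (b (Sum.inl (Fin.castLE (by omega) i))) (b (Sum.inl (Fin.castLE (by omega) i).rev))

/-- The root lattice `Q = ℤε_1 ⊕ ⋯ ⊕ ℤε_r`, where `ε_1, …, ε_r` is the basis dual to
`h_1, …, h_r`: the function `μ` stands for `∑ i, μ i • ε_i`, so `μ(h_i) = μ i`. -/
abbrev RootLattice (r : ℕ) : Type := Fin r → ℤ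

/-- `x` lies in the `μ`-weight space `X_μ` of `X` for the action of `h_1, …, h_r`. -/
def IsWeightVector {r : ℕ} {K : Type*} (F : Type*) [Field F] [Module F X]
    (ξ : HermitianForm A X)
    (b : Module.Basis (Fin (2 * r) ⊕ K) Aᵐᵒᵖ X) (μ : RootLattice r) (x : X) : Prop :=
  ∀ i : Fin r, cartan ξ b i x = (μ i : F) • x

/-- The sum of all `U(X_κ^ρ, X_μ^σ)` with `κ + μ = ν` and `ρ + σ = τ`. -/
def component {r : ℕ} {K : Type*} (𝒳 : Γ → Submodule F X) (ξ : HermitianForm A X)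
    (b : Module.Basis (Fin (2 * r) ⊕ K) Aᵐᵒᵖ X) (ν : RootLattice r) (τ : Γ) :
    Submodule F (Module.End Aᵐᵒᵖ X) :=
  Submodule.span F {T | ∃ (κ μ : RootLattice r) (ρ σ : Γ) (x y : X),
    κ + μ = ν ∧ ρ + σ = τ ∧ IsWeightVector F ξ b κ x ∧ x ∈ 𝒳 ρ ∧
    IsWeightVector F ξ b μ y ∧ y ∈ 𝒳 σ ∧ T = ξ.U x y}

/-- The `(ν, τ)`-component of the finite unitary Lie algebra. -/
def finiteUnitaryGrading {r : ℕ} {K : Type*} (𝒳 : Γ → Submodule F X) (ξ : HermitianForm A X)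
    (b : Module.Basis (Fin (2 * r) ⊕ K) Aᵐᵒᵖ X) (ν : RootLattice r) (τ : Γ) :
    Submodule F ↥(ξ.finiteUnitary F) :=
  (component 𝒳 ξ b ν τ).comap (ξ.finiteUnitary F).toSubmodule.subtype

/-- The `(ν, τ)`-component of the special unitary Lie algebra, a graded subalgebra of the
finite unitary Lie algebra. -/
def specialUnitaryGrading {r : ℕ} {K : Type*} (𝒳 : Γ → Submodule F X) (ξ : HermitianForm A X)
    (b : Module.Basis (Fin (2 * r) ⊕ K) Aᵐᵒᵖ X) (ν : RootLattice r) (τ : Γ) :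
    Submodule F ↥(ξ.specialUnitary F) :=
  (component 𝒳 ξ b ν τ).comap (ξ.specialUnitary F).toSubmodule.subtype

end Graded

/-! ### Bi-isomorphisms and compatible triples -/

/-- The `(Q × Γ)`-graded Lie algebra `ℒ` and the `(Q' × Γ')`-graded Lie algebra `ℒ'` are
bi-isomorphic. -/
def BiIsomorphic {F Q Γ ℒ Q' Γ' ℒ' : Type*} [Field F] [AddCommGroup Q] [AddCommGroup Γ]
    [LieRing ℒ] [LieAlgebra F ℒ] [AddCommGroup Q'] [AddCommGroup Γ'] [LieRing ℒ']
    [LieAlgebra F ℒ'] (g : Q → Γ → Submodule F ℒ) (g' : Q' → Γ' → Submodule F ℒ') : Prop :=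
  ∃ (ψ : ℒ ≃ₗ⁅F⁆ ℒ') (ψr : Q ≃+ Q') (ψe : Γ ≃+ Γ'),
    ∀ μ σ, (g μ σ).map (ψ.toLinearEquiv : ℒ →ₗ[F] ℒ') = g' (ψr μ) (ψe σ)

/-- The conditions on a triple of maps: `θ` is semilinear with respect to the isomorphism `θ₁` of
algebras with involution, `θ` and `θ₁` preserve the forms, and `θ`, `θ₁` respect the gradings
along `θ₂`. -/
structure IsCompatibleTriple {F Γ A X Γ' A' X' : Type*} [Field F]
    [AddCommGroup Γ] [Ring A] [StarRing A] [Algebra F A] [AddCommGroup X] [Module F X]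
    [Module Aᵐᵒᵖ X]
    [AddCommGroup Γ'] [Ring A'] [StarRing A'] [Algebra F A'] [AddCommGroup X'] [Module F X']
    [Module A'ᵐᵒᵖ X']
    (𝒜 : Γ → Submodule F A) (𝒳 : Γ → Submodule F X) (ξ : HermitianForm A X)
    (𝒜' : Γ' → Submodule F A') (𝒳' : Γ' → Submodule F X') (ξ' : HermitianForm A' X')
    (θ : X ≃ₗ[F] X') (θ₁ : A ≃ₐ[F] A') (θ₂ : Γ ≃+ Γ') : Prop where
  map_star : ∀ a, θ₁ (star a) = star (θ₁ a)
  map_smul : ∀ (x : X) (a : A),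
    θ (MulOpposite.op a • x) = MulOpposite.op (θ₁ a) • θ x
  map_form : ∀ x y, θ₁ (ξ x y) = ξ' (θ x) (θ y)
  map_torus : ∀ σ, (𝒜 σ).map (θ₁.toLinearEquiv : A →ₗ[F] A') = 𝒜' (θ₂ σ)
  map_module : ∀ σ, (𝒳 σ).map (θ : X →ₗ[F] X') = 𝒳' (θ₂ σ)

end UnitaryLieTorus

end

/-!
A compatible basis enters only through its *frame*: the hyperbolic vectors `e_p`, one for each
weight `p = ± ε_i`, and a unit vector `v` of degree `0` in the anisotropic part. All of them have
degree `0`, and together they span `X^0` over `F`. Indeed `A^0 = F`, so `X^0` is a quadratic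
space; in terms of a compatible basis it is the sum of `r` hyperbolic planes and an anisotropic
space, so its totally isotropic subspaces have dimension at most `r` (`finrank_isotropic_le`). The
Witt decomposition with finely graded anisotropic part then gives `dim X^0 ≤ 2r + 1`
(`IsCompatibleBasis.finrank_zero_le`).

Hence any two frames of the same form are exchanged by a graded isometry that fixes the orthogonal
complement of `X^0` (`IsFrame.exists_isometry`). For part (a), a given triple is composed with
such an isometry so as to match the two chosen frames; conjugation by the resulting semilinear map
sends `U(x, y)` to `U(θ x, θ y)` and preserves weights and degrees.

For part (b), a bi-isomorphism `ψ` maps short roots to short roots, since a long root is the sum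
of two nonzero vectors whose difference is a root or zero, and a short root is not
(`IsFrame.exists_map_wt`). For `p`, `q` with different underlying indices, the root space of `p +
q` is `{U(e_p, e_q.α)} ≅ A` and that of `p` is `{U(e_p, w)} ≅ X_0`, the space of weight-zero
vectors. So `ψ` induces graded linear isomorphisms `A ≃ A'` and `X_0 ≃ X_0'`, and the brackets
`[U(e_p, e_q.α), U(e_{-q}, w)] = U(e_p, w.α)` and `[U(e_p, w), U(e_q, w')] = -U(e_p, e_q.ξ(w',
w))` relate these to the module structure and to the form. The components of degree `0` of these
root spaces are one-dimensional, so the isomorphisms for different roots differ by scalars; after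
rescaling they form a semilinear isometry of weight-zero spaces, which extends to a compatible
triple (`exists_compatibleTriple`). This needs only two different indices, that is, `r ≥ 2`.
-/

noncomputable section

namespace UnitaryLieTorus

open scoped RightActions

/-! ### Hermitian forms and the operators `U(x, y)` -/

section Form

variable {F A X : Type*} [Field F] [Ring A] [StarRing A] [Algebra F A] [AddCommGroup X]
  [Module F X] [Module Aᵐᵒᵖ X]

namespace HermitianForm

theorem zero_left (ξ : HermitianForm A X) (x : X) : ξ 0 x = 0 := by
  simpa using ξ.sub_left 0 0 x

theorem zero_right (ξ : HermitianForm A X) (x : X) : ξ x 0 = 0 := by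
  simpa using ξ.sub_right x 0 0

theorem sum_left {ι : Type*} (ξ : HermitianForm A X) (s : Finset ι) (f : ι → X) (y : X) :
    ξ (∑ i ∈ s, f i) y = ∑ i ∈ s, ξ (f i) y :=
  map_sum (AddMonoidHom.mk' (fun x => ξ x y) fun a b => ξ.add_left a b y) f s

theorem sum_right {ι : Type*} (ξ : HermitianForm A X) (s : Finset ι) (x : X) (f : ι → X) :
    ξ x (∑ i ∈ s, f i) = ∑ i ∈ s, ξ x (f i) :=
  map_sum (AddMonoidHom.mk' (ξ x) (ξ.add_right x)) f s

theorem eq_zero_symm (ξ : HermitianForm A X) {x y : X} (h : ξ x y = 0) : ξ y x = 0 := by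
  rw [ξ.symm, h, star_zero]

theorem U_swap (ξ : HermitianForm A X) (x y : X) : ξ.U y x = -ξ.U x y := by
  simp [U]

theorem U_add_left (ξ : HermitianForm A X) (x y z : X) : ξ.U (x + y) z = ξ.U x z + ξ.U y z := by
  ext w
  simp only [U_apply, LinearMap.add_apply, ξ.add_left, MulOpposite.op_add, add_smul, smul_add]
  abel

theorem U_add_right (ξ : HermitianForm A X) (x y z : X) : ξ.U x (y + z) = ξ.U x y + ξ.U x z := by
  rw [ξ.U_swap, ξ.U_add_left, ξ.U_swap x y, ξ.U_swap x z, neg_add, neg_neg, neg_neg]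

theorem U_smul_left (ξ : HermitianForm A X) (x y : X) (a : A) :
    ξ.U (x <• a) y = ξ.U x (y <• star a) := by
  ext z
  simp only [U_apply, ξ.smul_left, star_star, MulOpposite.op_mul, mul_smul]

theorem U_zero_left (ξ : HermitianForm A X) (y : X) : ξ.U 0 y = 0 := by
  simpa using ξ.U_add_left 0 0 y

theorem U_zero_right (ξ : HermitianForm A X) (y : X) : ξ.U y 0 = 0 := by
  rw [ξ.U_swap, ξ.U_zero_left, neg_zero]

variable [IsScalarTower F Aᵐᵒᵖ X]

omit [StarRing A] in
/-- The two scalar actions on `X` agree on `F`. -/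
theorem smul_eq_op_smul (c : F) (x : X) : c • x = x <• algebraMap F A c := by
  rw [← MulOpposite.algebraMap_apply, algebraMap_smul]

theorem form_smul_right (ξ : HermitianForm A X) (c : F) (x y : X) :
    ξ x (c • y) = c • ξ x y := by
  rw [smul_eq_op_smul (A := A), ξ.smul_right, ← Algebra.commutes, Algebra.smul_def]

theorem form_smul_left (hstar : ∀ (c : F) (a : A), star (c • a) = c • star a)
    (ξ : HermitianForm A X) (c : F) (x y : X) : ξ (c • x) y = c • ξ x y := by
  rw [ξ.symm, form_smul_right, hstar, ← ξ.symm]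

theorem U_fsmul_left (hstar : ∀ (c : F) (a : A), star (c • a) = c • star a)
    (ξ : HermitianForm A X) (c : F) (x y : X) : ξ.U (c • x) y = c • ξ.U x y := by
  ext z
  simp only [U_apply, form_smul_left hstar, LinearMap.smul_apply, smul_sub,
    MulOpposite.op_smul, smul_assoc, smul_comm c (MulOpposite.op (ξ y z)) x]

theorem U_fsmul_right (hstar : ∀ (c : F) (a : A), star (c • a) = c • star a)
    (ξ : HermitianForm A X) (c : F) (x y : X) : ξ.U x (c • y) = c • ξ.U x y := by
  rw [ξ.U_swap, U_fsmul_left hstar, ξ.U_swap x y, smul_neg, neg_neg]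

end HermitianForm

end Form

/-! ### The degree-zero component of an associative torus -/

section Torus

variable {F Γ A X : Type*} [Field F] [AddCommGroup Γ] [Ring A] [StarRing A] [Algebra F A]
  [AddCommGroup X] [Module F X] [Module Aᵐᵒᵖ X]
  {L : AddSubgroup Γ} {𝒜 : Γ → Submodule F A}

/-- The degree-zero component is spanned by a unit `u`; since `u * u` is a multiple of `u`, the
unit `u` is a scalar. -/
theorem IsTorusWithInvolution.zero_eq_span_one (h : IsTorusWithInvolution L 𝒜) :
    𝒜 0 = Submodule.span F {1} := by
  have := h.nontrivial
  obtain ⟨u, hu, h0⟩ := h.exists_unit 0 L.zero_mem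
  have hmem : u ∈ 𝒜 0 := h0 ▸ Submodule.mem_span_singleton_self u
  have huu : u * u ∈ 𝒜 0 := by simpa using h.mul_mem hmem hmem
  rw [h0, Submodule.mem_span_singleton] at huu
  obtain ⟨c, hc⟩ := huu
  have hc1 : c • (1 : A) = u := hu.mul_right_cancel (by rw [← hc, smul_mul_assoc, one_mul])
  have hc0 : c ≠ 0 := by
    rintro rfl
    exact hu.ne_zero (by rw [← hc1, zero_smul])
  rw [h0, ← hc1]
  exact Submodule.span_singleton_smul_eq (IsUnit.mk0 c hc0) 1

theorem IsTorusWithInvolution.one_mem (h : IsTorusWithInvolution L 𝒜) : (1 : A) ∈ 𝒜 0 :=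
  h.zero_eq_span_one ▸ Submodule.mem_span_singleton_self 1

theorem IsTorusWithInvolution.exists_eq_smul_one (h : IsTorusWithInvolution L 𝒜) {a : A}
    (ha : a ∈ 𝒜 0) : ∃ c : F, a = c • 1 := by
  rw [h.zero_eq_span_one, Submodule.mem_span_singleton] at ha
  obtain ⟨c, hc⟩ := ha
  exact ⟨c, hc.symm⟩

theorem IsTorusWithInvolution.mem_iff_ne_bot (h : IsTorusWithInvolution L 𝒜) (σ : Γ) :
    σ ∈ L ↔ 𝒜 σ ≠ ⊥ := by
  have := h.nontrivial
  refine ⟨fun hσ => ?_, fun hσ => by_contra fun hL => hσ (h.eq_bot σ hL)⟩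
  obtain ⟨u, hu, hs⟩ := h.exists_unit σ hσ
  rw [hs, Ne, Submodule.span_singleton_eq_bot]
  exact hu.ne_zero

end Torus

/-! ### Signed indices and the weights of the natural module -/

/-- Indices of the nonzero weights of the natural module: `(i, s)` stands for the weight
`s ε_i`. -/
abbrev SignedIndex (r : ℕ) : Type := Fin r × ℤˣ

namespace SignedIndex

variable {r : ℕ}

/-- The index of the opposite weight. -/
def opp (p : SignedIndex r) : SignedIndex r := (p.1, -p.2)

/-- The weight `s ε_i` of the index `(i, s)`. -/
def wt (p : SignedIndex r) : RootLattice r := Pi.single p.1 (p.2 : ℤ)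

@[simp] theorem opp_fst (p : SignedIndex r) : p.opp.1 = p.1 := rfl

@[simp] theorem opp_opp (p : SignedIndex r) : p.opp.opp = p := by simp [opp]

theorem ne_opp (p : SignedIndex r) : p ≠ p.opp := fun h =>
  units_ne_neg_self p.2 (congrArg Prod.snd h)

theorem ne_of_fst_ne {p q : SignedIndex r} (h : p.1 ≠ q.1) : p ≠ q := fun h' => h (by rw [h'])

theorem eq_or_eq_opp {p q : SignedIndex r} (h : p.1 = q.1) : p = q ∨ p = q.opp := by
  rcases Int.units_eq_one_or p.2 with hp | hp <;> rcases Int.units_eq_one_or q.2 with hq | hq <;>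
    simp [opp, Prod.ext_iff, h, hp, hq]

theorem wt_opp (p : SignedIndex r) : p.opp.wt = -p.wt := by
  simp [opp, wt, Pi.single_neg]

theorem wt_apply (p : SignedIndex r) (i : Fin r) : p.wt i = if i = p.1 then (p.2 : ℤ) else 0 := by
  simp [wt, Pi.single_apply]

theorem snd_eq (p : SignedIndex r) : (p.2 : ℤ) = 1 ∨ (p.2 : ℤ) = -1 := by
  rcases Int.units_eq_one_or p.2 with h | h <;> simp [h]

theorem wt_injective : Function.Injective (wt : SignedIndex r → RootLattice r) := by
  intro p q h
  have h1 := congrFun h p.1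
  rw [wt_apply, wt_apply, if_pos rfl] at h1
  have := p.snd_eq
  split_ifs at h1 with h2
  · exact Prod.ext h2 (Units.ext h1)
  · omega

theorem wt_ne_zero (p : SignedIndex r) : p.wt ≠ 0 := by
  intro h
  have h1 := congrFun h p.1
  rw [wt_apply, if_pos rfl, Pi.zero_apply] at h1
  exact p.2.ne_zero h1

theorem wt_add_wt_ne_zero {p q : SignedIndex r} (hpq : p.1 ≠ q.1) : p.wt + q.wt ≠ 0 := fun h =>
  ne_of_fst_ne (q := q.opp) hpq
    (wt_injective (by rw [wt_opp]; exact eq_neg_of_add_eq_zero_left h))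

theorem wt_add_self_ne (a p : SignedIndex r) : a.wt + a.wt ≠ p.wt := by
  intro h
  have h1 := congrFun h p.1
  simp only [wt_apply, Pi.add_apply, if_true] at h1
  have := p.snd_eq
  split_ifs at h1 <;> omega

theorem wt_ne_wt_add_wt {p q a : SignedIndex r} (hpq : p.1 ≠ q.1) : a.wt ≠ p.wt + q.wt := by
  intro h
  have h1 := congrFun h p.1
  have h2 := congrFun h q.1
  simp only [wt_apply, Pi.add_apply, if_neg hpq, if_neg hpq.symm, if_true] at h1 h2
  have := p.snd_eq
  have := q.snd_eq
  split_ifs at h1 h2 <;> omega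

theorem wt_add_wt_eq {p q a c : SignedIndex r} (hpq : p.1 ≠ q.1)
    (h : a.wt + c.wt = p.wt + q.wt) : a = p ∧ c = q ∨ a = q ∧ c = p := by
  have h1 := congrFun h p.1
  simp only [wt_apply, Pi.add_apply, if_neg hpq, if_true] at h1
  have hp := p.snd_eq
  have ha := a.snd_eq
  have hc := c.snd_eq
  by_cases hpa : p.1 = a.1
  · have hpc : p.1 ≠ c.1 := by
      intro hpc
      rw [if_pos hpa, if_pos hpc] at h1
      omega
    rw [if_pos hpa, if_neg hpc] at h1
    have : a = p := Prod.ext hpa.symm (Units.ext (by omega))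
    subst this
    exact Or.inl ⟨rfl, wt_injective (add_left_cancel h)⟩
  · by_cases hpc : p.1 = c.1
    · rw [if_neg hpa, if_pos hpc] at h1
      have : c = p := Prod.ext hpc.symm (Units.ext (by omega))
      subst this
      exact Or.inr ⟨wt_injective (add_right_cancel (h.trans (add_comm _ _))), rfl⟩
    · rw [if_neg hpa, if_neg hpc] at h1
      omega

/-- A short root is not the sum of two nonzero vectors whose difference has `ℓ¹`-norm at
most `2`. -/
theorem eq_zero_or_eq_zero_of_sum_abs_le {p : SignedIndex r} {β γ : RootLattice r}
    (h : β + γ = p.wt) (hd : ∑ i, |(β - γ) i| ≤ 2) : β = 0 ∨ γ = 0 := by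
  have hβ : ∀ i, β i = p.wt i - γ i := fun i => by rw [← h, Pi.add_apply]; ring
  have hp := p.snd_eq
  have hsum : |(β - γ) p.1| + ∑ i ∈ Finset.univ.erase p.1, |(β - γ) i| ≤ 2 := by
    rwa [Finset.add_sum_erase _ (fun i => |(β - γ) i|) (Finset.mem_univ _)]
  have hnn : 0 ≤ ∑ i ∈ Finset.univ.erase p.1, |(β - γ) i| :=
    Finset.sum_nonneg fun i _ => abs_nonneg _
  -- `β - γ = wt p - 2 γ` is odd at `p.1` and even elsewhere, so norm `≤ 2` forces `±1` and `0`
  have hself : (β - γ) p.1 = p.2 - 2 * γ p.1 := by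
    rw [Pi.sub_apply, hβ, wt_apply, if_pos rfl]; ring
  have hother : ∀ i, i ≠ p.1 → γ i = 0 := by
    intro i hi
    have hle := Finset.single_le_sum (f := fun i => |(β - γ) i|) (fun i _ => abs_nonneg _)
      (Finset.mem_erase.2 ⟨hi, Finset.mem_univ i⟩)
    have he : (β - γ) i = - 2 * γ i := by
      rw [Pi.sub_apply, hβ, wt_apply, if_neg hi]; ring
    simp only [he] at hle
    rw [hself] at hsum
    have := le_abs_self (-2 * γ i)
    have := neg_le_abs (-2 * γ i)
    have := le_abs_self ((p.2 : ℤ) - 2 * γ p.1)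
    have := neg_le_abs ((p.2 : ℤ) - 2 * γ p.1)
    omega
  rw [hself] at hsum
  have := le_abs_self ((p.2 : ℤ) - 2 * γ p.1)
  have := neg_le_abs ((p.2 : ℤ) - 2 * γ p.1)
  have hcase : γ p.1 = 0 ∨ γ p.1 = p.2 := by omega
  rcases hcase with h0 | h0
  · right
    funext i
    by_cases hi : i = p.1
    · rw [hi, h0, Pi.zero_apply]
    · exact hother i hi
  · left
    funext i
    rw [hβ, wt_apply, Pi.zero_apply]
    by_cases hi : i = p.1
    · rw [if_pos hi, hi, h0, sub_self]
    · rw [if_neg hi, hother i hi, sub_self]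

theorem sum_abs_wt (p : SignedIndex r) : ∑ i, |p.wt i| = 1 := by
  rw [Finset.sum_eq_single p.1]
  · rw [wt_apply, if_pos rfl]
    rcases p.snd_eq with h | h <;> simp [h]
  · intro i _ hi
    rw [wt_apply, if_neg hi, abs_zero]
  · simp

end SignedIndex

open SignedIndex

/-! ### Frames and weight vectors -/

section Frame

variable {F Γ A X : Type*} [Field F] [AddCommGroup Γ] [Ring A] [StarRing A]
  [AddCommGroup X] [Module F X] [Module Aᵐᵒᵖ X]

/-- The part of a compatible basis used below: the hyperbolic vectors `e (i, 1) = x_i` and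
`e (i, -1) = x_{2r+1-i}`, and the anisotropic unit vector `v`, all of degree `0`. The last
condition says that `v` spans the weight-zero vectors of degree `0`. -/
structure IsFrame {r : ℕ} (𝒳 : Γ → Submodule F X) (ξ : HermitianForm A X)
    (e : SignedIndex r → X) (v : X) : Prop where
  mem : ∀ p, e p ∈ 𝒳 0
  mem_unit : v ∈ 𝒳 0
  form : ∀ p q, ξ (e p) (e q) = if q = p.opp then 1 else 0
  form_unit : ∀ p, ξ (e p) v = 0
  form_unit_unit : ξ v v = 1
  exists_eq_smul : ∀ x ∈ 𝒳 0, (∀ p, ξ (e p) x = 0) → ∃ c : F, x = c • v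

/-- The hyperbolic vectors of a compatible basis, indexed by signed indices. -/
def frameOfBasis {r : ℕ} {K : Type*} (b : Module.Basis (Fin (2 * r) ⊕ K) Aᵐᵒᵖ X)
    (p : SignedIndex r) : X :=
  if p.2 = 1 then b (Sum.inl (Fin.castLE (by omega) p.1))
  else b (Sum.inl (Fin.castLE (by omega) p.1).rev)

theorem cartan_eq {r : ℕ} {K : Type*} (ξ : HermitianForm A X)
    (b : Module.Basis (Fin (2 * r) ⊕ K) Aᵐᵒᵖ X) (i : Fin r) :
    cartan ξ b i = ξ.U (frameOfBasis b (i, 1)) (frameOfBasis b (i, -1)) := by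
  simp [cartan, frameOfBasis]

variable {r : ℕ} {K : Type*} {𝒳 : Γ → Submodule F X}
  {ξ : HermitianForm A X} {b : Module.Basis (Fin (2 * r) ⊕ K) Aᵐᵒᵖ X} {v : X}

local notation "ε" => frameOfBasis b

theorem cartan_apply (i : Fin r) (x : X) :
    cartan ξ b i x = ε (i, 1) <• ξ (ε (i, -1)) x - ε (i, -1) <• ξ (ε (i, 1)) x := by
  rw [cartan_eq, ξ.U_apply]

namespace IsFrame

theorem form_opp {e : SignedIndex r → X} (h : IsFrame 𝒳 ξ e v) (p : SignedIndex r) :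
    ξ (e p.opp) (e p) = 1 := by
  rw [h.form, opp_opp, if_pos rfl]

theorem form_ne {e : SignedIndex r → X} (h : IsFrame 𝒳 ξ e v) {p q : SignedIndex r}
    (hpq : q ≠ p.opp) : ξ (e p) (e q) = 0 := by
  rw [h.form, if_neg hpq]

theorem form_self_opp {e : SignedIndex r → X} (h : IsFrame 𝒳 ξ e v) (p : SignedIndex r) :
    ξ (e p) (e p.opp) = 1 := by
  rw [h.form, if_pos rfl]

theorem form_self {e : SignedIndex r → X} (h : IsFrame 𝒳 ξ e v) (p : SignedIndex r) :
    ξ (e p) (e p) = 0 := h.form_ne p.ne_opp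

theorem form_fst_ne {e : SignedIndex r → X} (h : IsFrame 𝒳 ξ e v) {p q : SignedIndex r}
    (hpq : p.1 ≠ q.1) : ξ (e p) (e q) = 0 := h.form_ne (ne_of_fst_ne hpq.symm)

/-- The coordinate of `h_i x` at `e (i, 1)` is that of `x`, and the one at `e (i, -1)` is its
negative. -/
theorem form_cartan (h : IsFrame 𝒳 ξ ε v) (i : Fin r) (x : X) :
    ξ (ε (i, -1)) (cartan ξ b i x) = ξ (ε (i, -1)) x ∧
      ξ (ε (i, 1)) (cartan ξ b i x) = -ξ (ε (i, 1)) x := by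
  have h1 := h.form_opp (i, 1)
  have h2 := h.form_self_opp (i, 1)
  simp only [opp] at h1 h2
  rw [cartan_apply, ξ.sub_right, ξ.sub_right]
  simp only [ξ.smul_right, h1, h2, h.form_self, zero_mul, one_mul, sub_zero, zero_sub,
    and_self]

theorem form_cartan_of_ne (h : IsFrame 𝒳 ξ ε v) {i : Fin r} {p : SignedIndex r} (hp : p.1 ≠ i)
    (x : X) : ξ (ε p) (cartan ξ b i x) = 0 := by
  rw [cartan_apply, ξ.sub_right]
  simp only [ξ.smul_right]
  rw [h.form_fst_ne (q := (i, 1)) hp, h.form_fst_ne (q := (i, -1)) hp]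
  simp

theorem isWeightVector_zero_iff (h : IsFrame 𝒳 ξ ε v) (x : X) :
    IsWeightVector F ξ b 0 x ↔ ∀ p, ξ (ε p) x = 0 := by
  constructor
  · intro hx p
    have hi := hx p.1
    rw [Pi.zero_apply, Int.cast_zero, zero_smul] at hi
    obtain ⟨h1, h2⟩ := h.form_cartan p.1 x
    rw [hi, ξ.zero_right] at h1 h2
    obtain ⟨i, s⟩ := p
    rcases Int.units_eq_one_or s with rfl | rfl
    · exact neg_eq_zero.1 h2.symm
    · exact h1.symm
  · intro hx i
    rw [cartan_apply, hx, hx]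
    simp

theorem isWeightVector_smul (h : IsFrame 𝒳 ξ ε v) (p : SignedIndex r) (a : A) :
    IsWeightVector F ξ b p.wt (ε p <• a) := by
  intro i
  rw [map_smul, cartan_apply, h.form, h.form, wt_apply]
  obtain ⟨j, s⟩ := p
  by_cases hij : i = j
  · subst hij
    rcases Int.units_eq_one_or s with rfl | rfl <;> simp [opp, Prod.ext_iff]
  · simp [opp, Prod.ext_iff, hij, Ne.symm hij]

variable [CharZero F] [Algebra F A] [IsScalarTower F Aᵐᵒᵖ X]

/-- A weight vector of nonzero weight is determined by one coordinate, and only the weights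
`± ε_i` occur. -/
theorem isWeightVector_cases (h : IsFrame 𝒳 ξ ε v) {μ : RootLattice r} {x : X}
    (hx : IsWeightVector F ξ b μ x) (hμ : μ ≠ 0) (hx0 : x ≠ 0) :
    ∃ p : SignedIndex r, μ = p.wt ∧ x = ε p <• ξ (ε p.opp) x := by
  obtain ⟨i, hi⟩ := Function.ne_iff.1 hμ
  rw [Pi.zero_apply] at hi
  have hm : (μ i : F) ≠ 0 := Int.cast_ne_zero.2 hi
  have hxi := hx i
  obtain ⟨h1, h2⟩ := h.form_cartan i x
  rw [hxi, HermitianForm.form_smul_right] at h1 h2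
  have h1' : ((μ i : F) - 1) • ξ (ε (i, -1)) x = 0 := by rw [sub_smul, one_smul, h1, sub_self]
  have h2' : ((μ i : F) + 1) • ξ (ε (i, 1)) x = 0 := by
    rw [add_smul, one_smul, h2, neg_add_cancel]
  -- `x` is a combination of `e (i, 1)` and `e (i, -1)`, which the other `h_j` annihilate
  have hother : ∀ j, j ≠ i → μ j = 0 := by
    intro j hj
    have hz : ∀ s, ξ (ε (j, s)) x = 0 := by
      intro s
      have := h.form_cartan_of_ne (i := i) (p := (j, s)) hj x
      rw [hxi, HermitianForm.form_smul_right] at this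
      exact (smul_eq_zero.1 this).resolve_left hm
    have hxj := hx j
    rw [cartan_apply, hz, hz] at hxj
    simp only [MulOpposite.op_zero, zero_smul, sub_self] at hxj
    have := (smul_eq_zero.1 hxj.symm).resolve_right hx0
    exact Int.cast_eq_zero.1 this
  have key : ∀ p : SignedIndex r, p.1 = i → μ i = p.2 → μ = p.wt := by
    rintro p rfl hp
    funext j
    rw [wt_apply]
    split_ifs with hj
    · rw [hj, hp]
    · exact hother j hj
  have hcar := cartan_apply (ξ := ξ) (b := b) i x
  rw [hxi] at hcar
  by_cases hp : μ i = 1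
  · refine ⟨(i, 1), key _ rfl (by simpa using hp), ?_⟩
    have h0 : ξ (ε (i, 1)) x = 0 := by
      refine (smul_eq_zero.1 h2').resolve_left ?_
      rw [hp]
      norm_num
    rw [h0, hp] at hcar
    simpa [opp] using hcar
  by_cases hq : μ i = -1
  · refine ⟨(i, -1), key _ rfl (by simpa using hq), ?_⟩
    have h0 : ξ (ε (i, -1)) x = 0 := by
      refine (smul_eq_zero.1 h1').resolve_left ?_
      rw [hq]
      norm_num
    rw [h0, hq] at hcar
    simpa [opp] using hcar
  · exfalso
    have h3 : ξ (ε (i, -1)) x = 0 := by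
      refine (smul_eq_zero.1 h1').resolve_left fun h0 => hp ?_
      exact_mod_cast sub_eq_zero.1 h0
    have h4 : ξ (ε (i, 1)) x = 0 := by
      refine (smul_eq_zero.1 h2').resolve_left fun h0 => hq ?_
      exact_mod_cast eq_neg_of_add_eq_zero_left h0
    rw [h3, h4] at hcar
    simp only [MulOpposite.op_zero, zero_smul, sub_self] at hcar
    exact (smul_ne_zero hm hx0) hcar

end IsFrame

end Frame

/-! ### Orthogonal projections along hyperbolic families -/

section Dual

variable {A X ι : Type*} [Ring A] [StarRing A] [AddCommGroup X] [Module Aᵐᵒᵖ X]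
  [Fintype ι] [DecidableEq ι]

/-- The family `f` is dual to its rearrangement along the involution `bar` of the indices. -/
structure IsSelfDual (ξ : HermitianForm A X) (bar : ι → ι) (f : ι → X) : Prop where
  bar_bar : ∀ i, bar (bar i) = i
  form : ∀ i j, ξ (f i) (f j) = if j = bar i then 1 else 0

/-- The component of `x` orthogonal to a self-dual family. -/
def perpPart (ξ : HermitianForm A X) (bar : ι → ι) (f : ι → X) : X →ₗ[Aᵐᵒᵖ] X :=
  LinearMap.id - ∑ i, ξ.E (f i) (f (bar i))

variable {ξ : HermitianForm A X} {bar : ι → ι} {f : ι → X}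

omit [DecidableEq ι] in
theorem perpPart_apply (x : X) :
    perpPart ξ bar f x = x - ∑ i, f i <• ξ (f (bar i)) x := by
  simp [perpPart, ξ.E_apply]

omit [DecidableEq ι] in
theorem perpPart_eq_self {x : X} (h : ∀ i, ξ (f i) x = 0) : perpPart ξ bar f x = x := by
  simp [perpPart_apply, h]

namespace IsSelfDual

theorem form_perpPart (h : IsSelfDual ξ bar f) (i : ι) (x : X) :
    ξ (f i) (perpPart ξ bar f x) = 0 := by
  rw [perpPart_apply, ξ.sub_right, ξ.sum_right, Finset.sum_eq_single (bar i)]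
  · rw [ξ.smul_right, h.form, if_pos rfl, h.bar_bar, one_mul, sub_self]
  · intro j _ hj
    rw [ξ.smul_right, h.form, if_neg hj, zero_mul]
  · simp

theorem form_sum (h : IsSelfDual ξ bar f) (i : ι) (a : ι → A) :
    ξ (f i) (∑ j, f j <• a j) = a (bar i) := by
  rw [ξ.sum_right, Finset.sum_eq_single (bar i)]
  · rw [ξ.smul_right, h.form, if_pos rfl, one_mul]
  · intro j _ hj
    rw [ξ.smul_right, h.form, if_neg hj, zero_mul]
  · simp

theorem perpPart_sum (h : IsSelfDual ξ bar f) (a : ι → A) :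
    perpPart ξ bar f (∑ j, f j <• a j) = 0 := by
  rw [perpPart_apply, sub_eq_zero]
  exact Finset.sum_congr rfl fun i _ => by rw [h.form_sum, h.bar_bar]

/-- Expansion of the form along a self-dual family and its orthogonal complement. -/
theorem form_eq (h : IsSelfDual ξ bar f) (x y : X) :
    ξ x y = ∑ i, ξ x (f (bar i)) * ξ (f i) y
      + ξ (perpPart ξ bar f x) (perpPart ξ bar f y) := by
  have h1 : ξ (perpPart ξ bar f x) (perpPart ξ bar f y) = ξ (perpPart ξ bar f x) y := by
    conv_lhs => rw [perpPart_apply y]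
    rw [ξ.sub_right, ξ.sum_right, Finset.sum_eq_zero, sub_zero]
    intro i _
    rw [ξ.smul_right, ξ.eq_zero_symm (h.form_perpPart i x), zero_mul]
  rw [h1, perpPart_apply, ξ.sub_left, ξ.sum_left]
  simp only [ξ.smul_left, ← ξ.symm]
  abel

end IsSelfDual

end Dual

section Graded

variable {F Γ A X : Type*} [Field F] [AddCommGroup Γ] [Ring A] [StarRing A] [Algebra F A]
  [AddCommGroup X] [Module F X] [Module Aᵐᵒᵖ X] {L : AddSubgroup Γ}
  {𝒜 : Γ → Submodule F A} {𝒳 : Γ → Submodule F X} {ξ : HermitianForm A X}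

theorem perpPart_mem {ι : Type*} [Fintype ι] {bar : ι → ι} {f : ι → X}
    (G : IsGradedForm 𝒜 𝒳 ξ) (hf : ∀ i, f i ∈ 𝒳 0) {σ : Γ} {x : X} (hx : x ∈ 𝒳 σ) :
    perpPart ξ bar f x ∈ 𝒳 σ := by
  rw [perpPart_apply]
  refine Submodule.sub_mem _ hx (Submodule.sum_mem _ fun i _ => ?_)
  simpa using G.smul_mem (hf i) (G.form_mem (hf (bar i)) hx)

/-! ### The degree-zero component of the module -/

/-- A functional on `A` that recovers scalars. -/
theorem IsTorusWithInvolution.exists_functional (T : IsTorusWithInvolution L 𝒜) :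
    ∃ l : A →ₗ[F] F, ∀ a ∈ 𝒜 0, a = l a • 1 := by
  have := T.nontrivial
  obtain ⟨l, hl⟩ := (Algebra.linearMap F A).exists_leftInverse_of_injective
    (LinearMap.ker_eq_bot.2 (algebraMap F A).injective)
  refine ⟨l, fun a ha => ?_⟩
  obtain ⟨c, rfl⟩ := T.exists_eq_smul_one ha
  have := LinearMap.congr_fun hl c
  simp only [LinearMap.comp_apply, Algebra.linearMap_apply, Algebra.algebraMap_eq_smul_one,
    LinearMap.id_apply] at this
  rw [this]

/-- A vector space of dimension `> r` cannot carry linear maps `a`, `c` to `F^r` with `c`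
injective on `ker a` and `c (ker a)` orthogonal to `range a`. -/
theorem finrank_le_of_orthogonal {W : Type*} [AddCommGroup W] [Module F W]
    [FiniteDimensional F W] {r : ℕ} (a c : W →ₗ[F] (Fin r → F))
    (hinj : ∀ w, a w = 0 → c w = 0 → w = 0)
    (horth : ∀ w w', a w = 0 → c w ⬝ᵥ a w' = 0) : Module.finrank F W ≤ r := by
  let g : LinearMap.ker a →ₗ[F] Module.Dual F (Fin r → F) :=
    (dotProductEquiv F (Fin r)).toLinearMap ∘ₗ c ∘ₗ (LinearMap.ker a).subtype
  have hg : Function.Injective g := by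
    rw [injective_iff_map_eq_zero]
    rintro ⟨w, hw⟩ h
    have hc : c w = 0 := by simpa [g] using h
    exact Subtype.ext (hinj w hw hc)
  have hle : LinearMap.range g ≤ (LinearMap.range a).dualAnnihilator := by
    rintro _ ⟨⟨w, hw⟩, rfl⟩
    rw [Submodule.mem_dualAnnihilator]
    rintro _ ⟨w', rfl⟩
    exact horth w w' hw
  have h1 := LinearMap.finrank_range_add_finrank_ker a
  have h2 := Subspace.finrank_add_finrank_dualAnnihilator_eq (LinearMap.range a)
  have h3 := Submodule.finrank_mono hle
  rw [LinearMap.finrank_range_of_inj hg] at h3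
  rw [Module.finrank_fin_fun] at h2
  omega

variable [IsScalarTower F Aᵐᵒᵖ X]

/-- The `F`-linear map `ξ(x, ·)`. -/
def HermitianForm.formₗ (F : Type*) [Field F] [Algebra F A] [Module F X]
    [IsScalarTower F Aᵐᵒᵖ X] (ξ : HermitianForm A X) (x : X) : X →ₗ[F] A where
  toFun := ξ x
  map_add' := ξ.add_right x
  map_smul' c y := ξ.form_smul_right c x y

variable {r : ℕ} {e : SignedIndex r → X}

/-- If the orthogonal complement of a hyperbolic family of `r` pairs is anisotropic in degree
zero, then totally isotropic subspaces of degree zero have dimension at most `r`. -/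
theorem finrank_isotropic_le (T : IsTorusWithInvolution L 𝒜) (G : IsGradedForm 𝒜 𝒳 ξ)
    (he : ∀ p, e p ∈ 𝒳 0) (hd : IsSelfDual ξ opp e)
    (han : ∀ x ∈ 𝒳 0, (∀ p, ξ (e p) x = 0) → ξ x x = 0 → x = 0)
    (W : Submodule F X) [FiniteDimensional F W] (hW : W ≤ 𝒳 0)
    (hiso : ∀ x ∈ W, ∀ y ∈ W, ξ x y = 0) : Module.finrank F W ≤ r := by
  have := T.nontrivial
  obtain ⟨l, hl⟩ := T.exists_functional
  let φ (s : ℤˣ) : W →ₗ[F] (Fin r → F) :=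
    LinearMap.pi fun i => l ∘ₗ ξ.formₗ F (e (i, s)) ∘ₗ W.subtype
  have hform : ∀ (w : W) (p : SignedIndex r), ξ (e p) w = φ p.2 w p.1 • 1 := fun w p =>
    hl _ (by simpa using G.form_mem (he p) (hW w.2))
  have hzero : ∀ (w : W) (s : ℤˣ), φ s w = 0 → ∀ i, ξ (e (i, s)) w = 0 := by
    intro w s h i
    rw [hform, h, Pi.zero_apply, zero_smul]
  -- the anisotropic part of a vector of `W` with vanishing coordinates `ξ(e (i, 1), w)` is
  -- isotropic
  have hperp : ∀ w : W, φ 1 w = 0 → perpPart ξ opp e (w : X) = 0 := by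
    intro w h
    refine han _ (perpPart_mem G he (hW w.2)) (fun p => hd.form_perpPart p _) ?_
    have h1 := hd.form_eq w w
    rw [hiso _ w.2 _ w.2, Finset.sum_eq_zero, zero_add] at h1
    · exact h1.symm
    · rintro ⟨i, s⟩ -
      rcases Int.units_eq_one_or s with rfl | rfl
      · rw [hzero w 1 h, mul_zero]
      · rw [ξ.symm (e _), opp, neg_neg, hzero w 1 h, star_zero, zero_mul]
  refine finrank_le_of_orthogonal (φ 1) (φ (-1)) ?_ ?_
  · intro w h1 h2
    have hw : ∀ p, ξ (e p) w = 0 := by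
      rintro ⟨i, s⟩
      rcases Int.units_eq_one_or s with rfl | rfl
      · exact hzero w 1 h1 i
      · exact hzero w (-1) h2 i
    exact Subtype.ext (han _ (hW w.2) hw (hiso _ w.2 _ w.2))
  · intro w w' h1
    have h2 := hd.form_eq w w'
    rw [hiso _ w.2 _ w'.2, hperp w h1, ξ.zero_left, add_zero, Fintype.sum_prod_type] at h2
    have h3 : ∀ i : Fin r, ∑ s : ℤˣ, ξ (w : X) (e (opp (i, s))) * ξ (e (i, s)) w' =
        (φ (-1) w i * φ 1 w' i) • 1 := by
      intro i
      rw [UnitsInt.univ, Finset.sum_pair (by decide)]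
      have h0 : ξ (w : X) (e (opp (i, -1))) = 0 := by
        rw [ξ.symm (e _), opp, neg_neg, hzero w 1 h1, star_zero]
      rw [h0, zero_mul, add_zero, ξ.symm (e _), hform, hform, T.star_smul, star_one, opp,
        smul_mul_smul_comm, one_mul]
    simp only [h3] at h2
    rw [← Finset.sum_smul] at h2
    exact (smul_eq_zero.1 h2.symm).resolve_right one_ne_zero

/-- In a degree-zero component of dimension at most `2r + 1`, the orthogonal complement of `r`
hyperbolic pairs is spanned by any of its nonzero vectors. -/
theorem exists_eq_smul_of_finrank_le (T : IsTorusWithInvolution L 𝒜)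
    [FiniteDimensional F (𝒳 0)]
    (he : ∀ p, e p ∈ 𝒳 0) (hd : IsSelfDual ξ opp e)
    (hdim : Module.finrank F (𝒳 0) ≤ 2 * r + 1) {v : X} (hv : v ∈ 𝒳 0)
    (hv' : ∀ p, ξ (e p) v = 0) (hv0 : v ≠ 0) {x : X} (hx : x ∈ 𝒳 0)
    (hx' : ∀ p, ξ (e p) x = 0) : ∃ c : F, x = c • v := by
  have := T.nontrivial
  obtain ⟨l, hl⟩ := T.exists_functional
  let φ : 𝒳 0 →ₗ[F] (SignedIndex r → F) :=
    LinearMap.pi fun p => l ∘ₗ ξ.formₗ F (e p) ∘ₗ (𝒳 0).subtype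
  have hl1 : l 1 = 1 := by
    have h := hl 1 T.one_mem
    have h' : (1 - l 1) • (1 : A) = 0 := by rw [sub_smul, one_smul, ← h, sub_self]
    exact (sub_eq_zero.1 ((smul_eq_zero.1 h').resolve_right one_ne_zero)).symm
  have hsurj : Function.Surjective φ := by
    intro f
    have hm : ∑ p, e p <• algebraMap F A (f p.opp) ∈ 𝒳 0 :=
      Submodule.sum_mem _ fun p _ => by
        rw [← HermitianForm.smul_eq_op_smul]
        exact Submodule.smul_mem _ _ (he p)
    refine ⟨⟨_, hm⟩, ?_⟩
    funext p
    change l (ξ (e p) (∑ p, e p <• algebraMap F A (f p.opp))) = f p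
    rw [hd.form_sum p fun p => algebraMap F A (f p.opp), opp_opp,
      Algebra.algebraMap_eq_smul_one, map_smul, hl1, smul_eq_mul, mul_one]
  have hker : ∀ y (h : y ∈ 𝒳 0), (∀ p, ξ (e p) y = 0) →
      (⟨y, h⟩ : 𝒳 0) ∈ LinearMap.ker φ := by
    intro y h hy
    rw [LinearMap.mem_ker]
    funext p
    change l (ξ (e p) y) = 0
    rw [hy, map_zero]
  have hrank := LinearMap.finrank_range_add_finrank_ker φ
  rw [LinearMap.range_eq_top.2 hsurj, finrank_top, Module.finrank_fintype_fun_eq_card,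
    Fintype.card_prod, Fintype.card_fin, Fintype.card_units_int] at hrank
  have hle : Module.finrank F (LinearMap.ker φ) ≤ 1 := by omega
  let v₁ : LinearMap.ker φ := ⟨⟨v, hv⟩, hker v hv hv'⟩
  let x₁ : LinearMap.ker φ := ⟨⟨x, hx⟩, hker x hx hx'⟩
  have hv₁ : v₁ ≠ 0 := fun h => hv0 (congrArg (fun y : LinearMap.ker φ => ((y : 𝒳 0) : X)) h)
  obtain ⟨w, hw⟩ := finrank_le_one_iff.1 hle
  obtain ⟨c, hc⟩ := hw v₁
  obtain ⟨d, hd⟩ := hw x₁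
  have hc0 : c ≠ 0 := by
    rintro rfl
    exact hv₁ (by rw [← hc, zero_smul])
  refine ⟨d * c⁻¹, congrArg (fun y : LinearMap.ker φ => ((y : 𝒳 0) : X)) (a₁ := x₁)
    (a₂ := (d * c⁻¹) • v₁) ?_⟩
  rw [← hc, smul_smul, mul_assoc, inv_mul_cancel₀ hc0, mul_one, hd]

end Graded

/-! ### Compatible bases yield frames -/

section FrameOfBasis

variable {F Γ A X : Type*} [Field F] [AddCommGroup Γ] [Ring A] [StarRing A] [Algebra F A]
  [AddCommGroup X] [Module F X] [Module Aᵐᵒᵖ X] {L : AddSubgroup Γ}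
  {𝒜 : Γ → Submodule F A} {𝒳 : Γ → Submodule F X} {ξ : HermitianForm A X}

open Classical in
/-- The projection onto the component of degree zero. -/
theorem exists_projection (h : DirectSum.IsInternal 𝒳) :
    ∃ π : X →ₗ[F] X, (∀ x ∈ 𝒳 0, π x = x) ∧ (∀ σ, σ ≠ 0 → ∀ x ∈ 𝒳 σ, π x = 0) ∧
      ∀ x, π x ∈ 𝒳 0 := by
  let E := LinearEquiv.ofBijective (DirectSum.coeLinearMap 𝒳) h
  have hE : ∀ σ (x : 𝒳 σ), E.symm (x : X) = DirectSum.lof F Γ (fun σ => 𝒳 σ) σ x := by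
    intro σ x
    rw [LinearEquiv.symm_apply_eq]
    exact (DirectSum.coeLinearMap_lof 𝒳 σ x).symm
  refine ⟨(𝒳 0).subtype ∘ₗ DirectSum.component F Γ (fun σ => 𝒳 σ) 0 ∘ₗ E.symm.toLinearMap,
    ?_, ?_, fun x => Submodule.coe_mem _⟩
  · intro x hx
    simp only [LinearMap.comp_apply, LinearEquiv.coe_coe, hE 0 ⟨x, hx⟩,
      DirectSum.component.lof_self, Submodule.subtype_apply]
  · intro σ hσ x hx
    simp only [LinearMap.comp_apply, LinearEquiv.coe_coe, hE σ ⟨x, hx⟩]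
    rw [DirectSum.component.of, dif_neg hσ, map_zero]

omit [StarRing A] [Algebra F A] in
theorem IsGradedSubmodule.projection_mem {W : Submodule Aᵐᵒᵖ X} (hW : IsGradedSubmodule 𝒳 W)
    {π : X →ₗ[F] X} (h0 : ∀ x ∈ 𝒳 0, π x = x) (h1 : ∀ σ, σ ≠ 0 → ∀ x ∈ 𝒳 σ, π x = 0)
    {x : X} (hx : x ∈ W) : π x ∈ W := by
  have h := hW x hx
  clear hx
  induction h using AddSubgroup.closure_induction with
  | mem y hy =>
    obtain ⟨hyW, σ, hσ⟩ := hy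
    by_cases h : σ = 0
    · subst h
      rwa [h0 y hσ]
    · rw [h1 σ h y hσ]
      exact W.zero_mem
  | zero => rw [map_zero]; exact W.zero_mem
  | add y z _ _ hy hz => rw [map_add]; exact W.add_mem hy hz
  | neg y _ hy => rw [map_neg]; exact W.neg_mem hy

variable {r : ℕ} {K : Type*}
  {b : Module.Basis (Fin (2 * r) ⊕ K) Aᵐᵒᵖ X}

omit [StarRing A] in
theorem frameOfBasis_mem_range (p : SignedIndex r) :
    ∃ j : Fin (2 * r), frameOfBasis b p = b (Sum.inl j) := by
  unfold frameOfBasis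
  split_ifs
  · exact ⟨_, rfl⟩
  · exact ⟨_, rfl⟩

omit [StarRing A] in
theorem exists_frameOfBasis_eq (j : Fin (2 * r)) :
    ∃ p : SignedIndex r, frameOfBasis b p = b (Sum.inl j) := by
  by_cases hj : (j : ℕ) < r
  · refine ⟨(⟨j, hj⟩, 1), ?_⟩
    rw [frameOfBasis, if_pos rfl]
    congr 2
  · refine ⟨(⟨2 * r - 1 - j, by omega⟩, -1), ?_⟩
    rw [frameOfBasis, if_neg (units_ne_neg_self 1).symm]
    congr 2
    ext
    simp only [Fin.val_rev, Fin.val_castLE]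
    omega

namespace IsCompatibleBasis

theorem isSelfDual (hb : IsCompatibleBasis 𝒜 𝒳 ξ b) : IsSelfDual ξ opp (frameOfBasis b) where
  bar_bar := opp_opp
  form := by
    rintro ⟨i, s⟩ ⟨j, t⟩
    have hi := i.2
    have hj := j.2
    rcases Int.units_eq_one_or s with rfl | rfl <;> rcases Int.units_eq_one_or t with rfl | rfl <;>
      simp [frameOfBasis, hb.form_hyp, opp, Prod.ext_iff, Fin.ext_iff, Fin.val_rev] <;>
      first
        | omega
        | (congr 1; exact propext ⟨fun h => by omega, fun h => by omega⟩)

theorem frame_mem (hb : IsCompatibleBasis 𝒜 𝒳 ξ b) (p : SignedIndex r) :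
    frameOfBasis b p ∈ 𝒳 0 := by
  obtain ⟨j, hj⟩ := frameOfBasis_mem_range (b := b) p
  rw [hj]
  exact hb.deg_hyp j

/-- The vectors orthogonal to the hyperbolic part lie in the anisotropic part. -/
theorem mem_anisotropic (hb : IsCompatibleBasis 𝒜 𝒳 ξ b) {x : X}
    (hx : ∀ p, ξ (frameOfBasis b p) x = 0) :
    x ∈ Submodule.span Aᵐᵒᵖ (Set.range fun k : K => b (Sum.inr k)) := by
  have hmem : x ∈ (⊤ : Submodule Aᵐᵒᵖ X) := trivial
  rw [← hb.witt.isCompl.sup_eq_top] at hmem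
  obtain ⟨h, hh, n, hn, rfl⟩ := Submodule.mem_sup.1 hmem
  have h0 : h = 0 := by
    refine hb.witt.hyperbolic.1 h hh fun y hy => ?_
    induction hy using Submodule.span_induction with
    | zero => exact ξ.zero_right h
    | add y z _ _ hy hz => rw [ξ.add_right, hy, hz, add_zero]
    | smul a y _ hy =>
      induction a using MulOpposite.rec' with
      | h a => rw [ξ.smul_right, hy, zero_mul]
    | mem y hy =>
      obtain ⟨j, rfl⟩ := hy
      obtain ⟨p, hp⟩ := exists_frameOfBasis_eq (b := b) j
      have h1 := hx p
      rw [hp, ξ.add_right, hb.witt.orthogonal _ (Submodule.subset_span ⟨j, rfl⟩) n hn,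
        add_zero] at h1
      exact ξ.eq_zero_symm h1
  rwa [h0, zero_add]

variable [IsScalarTower F Aᵐᵒᵖ X]

/-- The degree-zero part of a Witt decomposition whose anisotropic part is finely graded has
dimension at most `2r + 1`, since both of its isotropic summands have dimension at most `r`. -/
theorem finrank_zero_le (hb : IsCompatibleBasis 𝒜 𝒳 ξ b)
    (D : IsUnitaryTorusData r L 𝒜 𝒳 ξ) : Module.finrank F (𝒳 0) ≤ 2 * r + 1 := by
  have := D.finite_dim 0
  obtain ⟨H, N, hW, -, -, hN⟩ := D.witt_decomposition
  obtain ⟨W₁, W₂, hs⟩ := hW.hyperbolic.2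
  obtain ⟨π, h0, h1, hπ⟩ := exists_projection D.graded.isInternal
  have hle : 𝒳 0 ≤ (W₁.restrictScalars F ⊓ 𝒳 0 ⊔ W₂.restrictScalars F ⊓ 𝒳 0) ⊔
      N.restrictScalars F ⊓ 𝒳 0 := by
    intro x hx
    have hmem : x ∈ (⊤ : Submodule Aᵐᵒᵖ X) := trivial
    rw [← hW.isCompl.sup_eq_top, ← hs.sup_eq] at hmem
    obtain ⟨y, hy, n, hn, hyn⟩ := Submodule.mem_sup.1 hmem
    obtain ⟨w₁, hw₁, w₂, hw₂, rfl⟩ := Submodule.mem_sup.1 hy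
    rw [← h0 x hx, ← hyn, map_add, map_add]
    exact Submodule.add_mem_sup (Submodule.add_mem_sup
      ⟨hs.graded₁.projection_mem h0 h1 hw₁, hπ _⟩ ⟨hs.graded₂.projection_mem h0 h1 hw₂, hπ _⟩)
      ⟨hW.graded_an.projection_mem h0 h1 hn, hπ _⟩
  have han : ∀ x ∈ 𝒳 0, (∀ p, ξ (frameOfBasis b p) x = 0) → ξ x x = 0 → x = 0 :=
    fun x hx hx' hxx => by_contra fun hne =>
      hb.witt.anisotropic x (hb.mem_anisotropic hx') ⟨0, hx⟩ hne hxx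
  have hfin : ∀ W : Submodule F X, FiniteDimensional F ↥(W ⊓ 𝒳 0) := fun W =>
    Submodule.finiteDimensional_of_le (inf_le_right : W ⊓ 𝒳 0 ≤ 𝒳 0)
  have := hfin (W₁.restrictScalars F)
  have := hfin (W₂.restrictScalars F)
  have := hfin (N.restrictScalars F)
  have d1 := finrank_isotropic_le D.torus D.graded hb.frame_mem hb.isSelfDual han
    (W₁.restrictScalars F ⊓ 𝒳 0) inf_le_right
    fun x hx y hy => hs.isotropic₁ x hx.1 y hy.1
  have d2 := finrank_isotropic_le D.torus D.graded hb.frame_mem hb.isSelfDual han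
    (W₂.restrictScalars F ⊓ 𝒳 0) inf_le_right
    fun x hx y hy => hs.isotropic₂ x hx.1 y hy.1
  have d3 : Module.finrank F ↥(N.restrictScalars F ⊓ 𝒳 0) ≤ 1 := by
    have := hN 0
    rw [← Module.finrank_eq_rank] at this
    exact_mod_cast this
  have d4 := Submodule.finrank_mono hle
  have d5 := Submodule.finrank_add_le_finrank_add_finrank
    (W₁.restrictScalars F ⊓ 𝒳 0) (W₂.restrictScalars F ⊓ 𝒳 0)
  have d6 := Submodule.finrank_add_le_finrank_add_finrank
    (W₁.restrictScalars F ⊓ 𝒳 0 ⊔ W₂.restrictScalars F ⊓ 𝒳 0) (N.restrictScalars F ⊓ 𝒳 0)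
  omega

/-- Since `dim X^0 ≤ 2r + 1`, the degree-zero part of the anisotropic summand of a compatible basis
is spanned by its unit vector. -/
theorem exists_isFrame (hb : IsCompatibleBasis 𝒜 𝒳 ξ b) (D : IsUnitaryTorusData r L 𝒜 𝒳 ξ) :
    ∃ v, IsFrame 𝒳 ξ (frameOfBasis b) v := by
  have := D.torus.nontrivial
  have := D.finite_dim 0
  obtain ⟨k, hk, hk1⟩ := hb.exists_one
  have horth : ∀ p, ξ (frameOfBasis b p) (b (Sum.inr k)) = 0 := by
    intro p
    obtain ⟨j, hj⟩ := frameOfBasis_mem_range (b := b) p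
    rw [hj]
    exact hb.witt.orthogonal _ (Submodule.subset_span ⟨j, rfl⟩) _
      (Submodule.subset_span ⟨k, rfl⟩)
  refine ⟨b (Sum.inr k), ⟨hb.frame_mem, hk, hb.isSelfDual.form, horth, hk1, ?_⟩⟩
  intro x hx hx'
  refine exists_eq_smul_of_finrank_le D.torus hb.frame_mem hb.isSelfDual
    (hb.finrank_zero_le D) hk horth ?_ hx hx'
  intro h0
  rw [h0, ξ.zero_left] at hk1
  exact zero_ne_one hk1

end IsCompatibleBasis

end FrameOfBasis

/-! ### Isometries between frames -/

section Exchange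

variable {A X ι : Type*} [Ring A] [StarRing A] [AddCommGroup X] [Module Aᵐᵒᵖ X]
  [Fintype ι]

/-- The linear map that sends a self-dual family `f` to `g` and fixes the vectors orthogonal
to `f`. -/
def exchange (ξ : HermitianForm A X) (bar : ι → ι) (f g : ι → X) : X →ₗ[Aᵐᵒᵖ] X :=
  perpPart ξ bar f + ∑ i, ξ.E (g i) (f (bar i))

variable {ξ : HermitianForm A X} {bar : ι → ι} {f g : ι → X}

theorem exchange_apply (x : X) : exchange ξ bar f g x =
    perpPart ξ bar f x + ∑ i, g i <• ξ (f (bar i)) x := by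
  simp [exchange, ξ.E_apply]

variable [DecidableEq ι]

theorem exchange_self (hf : IsSelfDual ξ bar f) (i : ι) : exchange ξ bar f g (f i) = g i := by
  have key : ∀ k : ι → X, ∑ j, k j <• ξ (f (bar j)) (f i) = k i := by
    intro k
    rw [Finset.sum_eq_single i]
    · rw [hf.form, hf.bar_bar, if_pos rfl, MulOpposite.op_one, one_smul]
    · intro j _ hj
      rw [hf.form, hf.bar_bar, if_neg hj.symm, MulOpposite.op_zero, zero_smul]
    · simp
  rw [exchange_apply, perpPart_apply, key, key, sub_self, zero_add]

theorem form_exchange (hf : IsSelfDual ξ bar f) (hg : IsSelfDual ξ bar g)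
    (hfg : ∀ x, (∀ i, ξ (f i) x = 0) → ∀ i, ξ (g i) x = 0) (i : ι) (x : X) :
    ξ (g i) (exchange ξ bar f g x) = ξ (f i) x := by
  rw [exchange_apply, ξ.add_right, hfg _ (fun j => hf.form_perpPart j x), zero_add,
    hg.form_sum i fun j => ξ (f (bar j)) x, hf.bar_bar]

theorem perpPart_exchange (hf : IsSelfDual ξ bar f) (hg : IsSelfDual ξ bar g)
    (hfg : ∀ x, (∀ i, ξ (f i) x = 0) → ∀ i, ξ (g i) x = 0) (x : X) :
    perpPart ξ bar g (exchange ξ bar f g x) = perpPart ξ bar f x := by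
  rw [exchange_apply, map_add, hg.perpPart_sum fun j => ξ (f (bar j)) x, add_zero,
    perpPart_eq_self (hfg _ fun j => hf.form_perpPart j x)]

theorem exchange_exchange (hf : IsSelfDual ξ bar f) (hg : IsSelfDual ξ bar g)
    (hfg : ∀ x, (∀ i, ξ (f i) x = 0) → ∀ i, ξ (g i) x = 0) (x : X) :
    exchange ξ bar g f (exchange ξ bar f g x) = x := by
  rw [exchange_apply, perpPart_exchange hf hg hfg]
  simp only [form_exchange hf hg hfg, perpPart_apply, sub_add_cancel]

theorem form_exchange_exchange (hf : IsSelfDual ξ bar f) (hg : IsSelfDual ξ bar g)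
    (hfg : ∀ x, (∀ i, ξ (f i) x = 0) → ∀ i, ξ (g i) x = 0) (x y : X) :
    ξ (exchange ξ bar f g x) (exchange ξ bar f g y) = ξ x y := by
  rw [hg.form_eq (exchange ξ bar f g x), hf.form_eq x y, perpPart_exchange hf hg hfg,
    perpPart_exchange hf hg hfg]
  congr 1
  refine Finset.sum_congr rfl fun i _ => ?_
  rw [ξ.symm (g _) (exchange _ _ _ _ _), form_exchange hf hg hfg, form_exchange hf hg hfg,
    ← ξ.symm]

end Exchange

section Isometry

variable {F Γ A X : Type*} [Field F] [AddCommGroup Γ] [Ring A] [StarRing A] [Algebra F A]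
  [AddCommGroup X] [Module F X] [Module Aᵐᵒᵖ X]
  {𝒜 : Γ → Submodule F A} {𝒳 : Γ → Submodule F X} {ξ : HermitianForm A X}

theorem exchange_mem {ι : Type*} [Fintype ι] {bar : ι → ι} {f g : ι → X}
    (G : IsGradedForm 𝒜 𝒳 ξ) (hf : ∀ i, f i ∈ 𝒳 0) (hg : ∀ i, g i ∈ 𝒳 0) {σ : Γ} {x : X}
    (hx : x ∈ 𝒳 σ) : exchange ξ bar f g x ∈ 𝒳 σ := by
  rw [exchange_apply]
  refine Submodule.add_mem _ (perpPart_mem G hf hx) (Submodule.sum_mem _ fun i _ => ?_)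
  simpa using G.smul_mem (hg i) (G.form_mem (hf (bar i)) hx)

namespace IsFrame

variable {r : ℕ} {e : SignedIndex r → X} {v : X}

omit [Algebra F A] in
theorem isSelfDual (h : IsFrame 𝒳 ξ e v) : IsSelfDual ξ opp e := ⟨opp_opp, h.form⟩

omit [Algebra F A] in
/-- The hyperbolic vectors together with the unit vector, which is its own dual. -/
theorem isSelfDual_option (h : IsFrame 𝒳 ξ e v) :
    IsSelfDual ξ (Option.map opp) (fun o => Option.elim o v e) where
  bar_bar o := by cases o <;> simp
  form o o' := by
    cases o <;> cases o' <;>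
      simp [h.form, h.form_unit, h.form_unit_unit, ξ.eq_zero_symm (h.form_unit _)]

omit [Algebra F A] in
theorem mem_option (h : IsFrame 𝒳 ξ e v) (o : Option (SignedIndex r)) :
    Option.elim o v e ∈ 𝒳 0 := by
  cases o
  · exact h.mem_unit
  · exact h.mem _

variable [IsScalarTower F Aᵐᵒᵖ X]

/-- A frame spans the degree-zero component, so a vector orthogonal to it is orthogonal to all
vectors of degree zero. -/
theorem form_eq_zero (G : IsGradedForm 𝒜 𝒳 ξ) (h : IsFrame 𝒳 ξ e v) {x : X}
    (hx : ∀ o : Option (SignedIndex r), ξ (Option.elim o v e) x = 0) {y : X} (hy : y ∈ 𝒳 0) :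
    ξ y x = 0 := by
  have hx' : ∀ p, ξ (e p) x = 0 := fun p => hx (some p)
  obtain ⟨c, hc⟩ := h.exists_eq_smul _ (perpPart_mem (bar := opp) G h.mem hy)
    (fun p => h.isSelfDual.form_perpPart p y)
  rw [h.isSelfDual.form_eq y x, perpPart_eq_self hx', hc,
    HermitianForm.smul_eq_op_smul (A := A), ξ.smul_left]
  simp [hx', show ξ v x = 0 from hx none]

/-- Any two frames are conjugate under a graded isometry. -/
theorem exists_isometry (G : IsGradedForm 𝒜 𝒳 ξ) (h : IsFrame 𝒳 ξ e v)
    {e' : SignedIndex r → X} {v' : X} (h' : IsFrame 𝒳 ξ e' v') :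
    ∃ T : X ≃ₗ[Aᵐᵒᵖ] X, (∀ p, T (e p) = e' p) ∧ (∀ x y, ξ (T x) (T y) = ξ x y) ∧
      ∀ σ x, T x ∈ 𝒳 σ ↔ x ∈ 𝒳 σ := by
  have h1 := h.isSelfDual_option
  have h2 := h'.isSelfDual_option
  have h12 := fun x hx i => form_eq_zero G h (x := x) hx (h'.mem_option i)
  have h21 := fun x hx i => form_eq_zero G h' (x := x) hx (h.mem_option i)
  refine ⟨LinearEquiv.ofLinearMap (exchange ξ _ _ _) (exchange ξ _ _ _)
    (LinearMap.ext (exchange_exchange h2 h1 h21)) (LinearMap.ext (exchange_exchange h1 h2 h12)),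
    fun p => exchange_self h1 (some p), form_exchange_exchange h1 h2 h12, fun σ x => ⟨?_, ?_⟩⟩
  · intro hx
    rw [← exchange_exchange h1 h2 h12 x]
    exact exchange_mem G h'.mem_option h.mem_option hx
  · exact exchange_mem G h.mem_option h'.mem_option

end IsFrame

end Isometry

/-! ### Transport of the graded Lie algebras along a compatible triple -/

section Transport

variable {F Γ A X Γ' A' X' : Type*} [Field F]
  [AddCommGroup Γ] [Ring A] [StarRing A] [Algebra F A] [AddCommGroup X] [Module F X]
  [Module Aᵐᵒᵖ X] [IsScalarTower F Aᵐᵒᵖ X]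
  [AddCommGroup Γ'] [Ring A'] [StarRing A'] [Algebra F A'] [AddCommGroup X'] [Module F X']
  [Module A'ᵐᵒᵖ X'] [IsScalarTower F A'ᵐᵒᵖ X']

omit [StarRing A] [StarRing A'] [IsScalarTower F Aᵐᵒᵖ X] [IsScalarTower F A'ᵐᵒᵖ X'] in
theorem semilinear_symm {θ : X ≃ₗ[F] X'} {θ₁ : A ≃ₐ[F] A'}
    (h : ∀ (x : X) (a : A), θ (x <• a) = θ x <• θ₁ a) (x : X') (a : A') :
    θ.symm (x <• a) = θ.symm x <• θ₁.symm a := by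
  rw [LinearEquiv.symm_apply_eq, h, LinearEquiv.apply_symm_apply, AlgEquiv.apply_symm_apply]

/-- Conjugation by a semilinear equivalence. -/
def conjFun (θ : X ≃ₗ[F] X') (θ₁ : A ≃ₐ[F] A') (h : ∀ (x : X) (a : A), θ (x <• a) = θ x <• θ₁ a)
    (T : Module.End Aᵐᵒᵖ X) : Module.End A'ᵐᵒᵖ X' where
  toFun x := θ (T (θ.symm x))
  map_add' x y := by simp
  map_smul' c x := by
    induction c using MulOpposite.rec' with
    | h a =>
      rw [semilinear_symm h, map_smul, h, AlgEquiv.apply_symm_apply, RingHom.id_apply]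

/-- Conjugation by a semilinear equivalence, as an isomorphism of Lie algebras. -/
def conjEquiv (θ : X ≃ₗ[F] X') (θ₁ : A ≃ₐ[F] A')
    (h : ∀ (x : X) (a : A), θ (x <• a) = θ x <• θ₁ a) :
    Module.End Aᵐᵒᵖ X ≃ₗ⁅F⁆ Module.End A'ᵐᵒᵖ X' where
  toFun := conjFun θ θ₁ h
  map_add' S T := by ext x; simp [conjFun]
  map_smul' c T := by ext x; simp [conjFun]
  map_lie' {S T} := by ext x; simp [conjFun, Ring.lie_def]
  invFun := conjFun θ.symm θ₁.symm (semilinear_symm h)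
  left_inv T := by ext x; simp [conjFun]
  right_inv T := by ext x; simp [conjFun]

/-- An isomorphism of ambient Lie algebras that matches two subalgebras and the families `C`, `C'`
of subspaces induces a bi-isomorphism which is the identity on `Q`. -/
theorem BiIsomorphic.of_subalgebras {Q 𝓔 𝓔' : Type*} [AddCommGroup Q] [LieRing 𝓔]
    [LieAlgebra F 𝓔] [LieRing 𝓔'] [LieAlgebra F 𝓔'] (Φ : 𝓔 ≃ₗ⁅F⁆ 𝓔') (θ₂ : Γ ≃+ Γ')
    (S : LieSubalgebra F 𝓔) (S' : LieSubalgebra F 𝓔')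
    (hS : S.map (Φ : 𝓔 →ₗ⁅F⁆ 𝓔') = S') (C : Q → Γ → Submodule F 𝓔)
    (C' : Q → Γ' → Submodule F 𝓔')
    (hC : ∀ μ σ x, Φ x ∈ C' μ (θ₂ σ) ↔ x ∈ C μ σ) :
    BiIsomorphic (ℒ := S) (ℒ' := S') (fun μ σ => (C μ σ).comap S.toSubmodule.subtype)
      (fun μ σ => (C' μ σ).comap S'.toSubmodule.subtype) := by
  refine ⟨LieEquiv.ofSubalgebras S S' Φ hS, AddEquiv.refl Q, θ₂, fun μ σ => ?_⟩
  ext y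
  constructor
  · rintro ⟨x, hx, rfl⟩
    exact (hC μ σ _).2 hx
  · intro hy
    obtain ⟨x, rfl⟩ := (LieEquiv.ofSubalgebras S S' Φ hS).surjective y
    exact ⟨x, (hC μ σ _).1 hy, rfl⟩

variable {𝒜 : Γ → Submodule F A} {𝒳 : Γ → Submodule F X} {ξ : HermitianForm A X}
  {𝒜' : Γ' → Submodule F A'} {𝒳' : Γ' → Submodule F X'} {ξ' : HermitianForm A' X'}
  {θ : X ≃ₗ[F] X'} {θ₁ : A ≃ₐ[F] A'} {θ₂ : Γ ≃+ Γ'}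

namespace IsCompatibleTriple

omit [IsScalarTower F Aᵐᵒᵖ X] [IsScalarTower F A'ᵐᵒᵖ X'] in
theorem mem_iff (h : IsCompatibleTriple 𝒜 𝒳 ξ 𝒜' 𝒳' ξ' θ θ₁ θ₂) (σ : Γ) (x : X) :
    θ x ∈ 𝒳' (θ₂ σ) ↔ x ∈ 𝒳 σ := by
  rw [← h.map_module]
  exact Function.Injective.mem_set_image θ.injective

theorem conj_U (h : IsCompatibleTriple 𝒜 𝒳 ξ 𝒜' 𝒳' ξ' θ θ₁ θ₂) (x y : X) :
    conjEquiv θ θ₁ h.map_smul (ξ.U x y) = ξ'.U (θ x) (θ y) := by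
  ext z
  change θ (ξ.U x y (θ.symm z)) = _
  rw [ξ.U_apply, ξ'.U_apply, map_sub, h.map_smul, h.map_smul, h.map_form, h.map_form,
    LinearEquiv.apply_symm_apply]

theorem map_finiteUnitary (h : IsCompatibleTriple 𝒜 𝒳 ξ 𝒜' 𝒳' ξ' θ θ₁ θ₂) :
    (ξ.finiteUnitary F).map (conjEquiv θ θ₁ h.map_smul : _ →ₗ⁅F⁆ _) = ξ'.finiteUnitary F := by
  rw [← LieSubalgebra.toSubmodule_inj]
  change Submodule.map (conjEquiv θ θ₁ h.map_smul).toLinearEquiv.toLinearMap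
    (Submodule.span F _) = Submodule.span F _
  rw [Submodule.map_span]
  congr 1
  ext T
  constructor
  · rintro ⟨_, ⟨x, y, rfl⟩, rfl⟩
    exact ⟨_, _, h.conj_U x y⟩
  · rintro ⟨x, y, rfl⟩
    refine ⟨_, ⟨θ.symm x, θ.symm y, rfl⟩, (h.conj_U _ _).trans ?_⟩
    rw [LinearEquiv.apply_symm_apply, LinearEquiv.apply_symm_apply]

theorem map_specialUnitary (h : IsCompatibleTriple 𝒜 𝒳 ξ 𝒜' 𝒳' ξ' θ θ₁ θ₂) :
    (ξ.specialUnitary F).map (conjEquiv θ θ₁ h.map_smul : _ →ₗ⁅F⁆ _) = ξ'.specialUnitary F := by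
  rw [← LieSubalgebra.toSubmodule_inj]
  change Submodule.map (conjEquiv θ θ₁ h.map_smul).toLinearEquiv.toLinearMap
    (Submodule.span F _) = Submodule.span F _
  rw [Submodule.map_span]
  congr 1
  ext T
  constructor
  · rintro ⟨_, ⟨S₁, h₁, S₂, h₂, rfl⟩, rfl⟩
    refine ⟨conjEquiv θ θ₁ h.map_smul S₁, ?_, conjEquiv θ θ₁ h.map_smul S₂, ?_,
      (conjEquiv θ θ₁ h.map_smul).map_lie S₁ S₂⟩
    · rw [← h.map_finiteUnitary]
      exact ⟨S₁, h₁, rfl⟩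
    · rw [← h.map_finiteUnitary]
      exact ⟨S₂, h₂, rfl⟩
  · rintro ⟨S₁, h₁, S₂, h₂, rfl⟩
    rw [← h.map_finiteUnitary] at h₁ h₂
    obtain ⟨T₁, h₁, rfl⟩ := h₁
    obtain ⟨T₂, h₂, rfl⟩ := h₂
    exact ⟨_, ⟨T₁, h₁, T₂, h₂, rfl⟩, (conjEquiv θ θ₁ h.map_smul).map_lie T₁ T₂⟩

variable {r : ℕ} {K K' : Type*} {b : Module.Basis (Fin (2 * r) ⊕ K) Aᵐᵒᵖ X}
  {b' : Module.Basis (Fin (2 * r) ⊕ K') A'ᵐᵒᵖ X'}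

theorem isWeightVector_iff (h : IsCompatibleTriple 𝒜 𝒳 ξ 𝒜' 𝒳' ξ' θ θ₁ θ₂)
    (hθ : ∀ p, θ (frameOfBasis b p) = frameOfBasis b' p) (μ : RootLattice r) (x : X) :
    IsWeightVector F ξ' b' μ (θ x) ↔ IsWeightVector F ξ b μ x := by
  have hc : ∀ i, cartan ξ' b' i (θ x) = θ (cartan ξ b i x) := by
    intro i
    rw [cartan_eq, cartan_eq, ← hθ, ← hθ, ← h.conj_U]
    change θ (_) = _
    rw [LinearEquiv.symm_apply_apply]
  refine forall_congr' fun i => ?_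
  rw [hc, ← _root_.map_smul, θ.injective.eq_iff]

theorem conj_mem_component_iff (h : IsCompatibleTriple 𝒜 𝒳 ξ 𝒜' 𝒳' ξ' θ θ₁ θ₂)
    (hθ : ∀ p, θ (frameOfBasis b p) = frameOfBasis b' p) (ν : RootLattice r) (τ : Γ)
    (T : Module.End Aᵐᵒᵖ X) :
    conjEquiv θ θ₁ h.map_smul T ∈ component 𝒳' ξ' b' ν (θ₂ τ) ↔ T ∈ component 𝒳 ξ b ν τ := by
  have key : (component 𝒳 ξ b ν τ).map
      (conjEquiv θ θ₁ h.map_smul).toLinearEquiv.toLinearMap =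
      component 𝒳' ξ' b' ν (θ₂ τ) := by
    rw [component, component, Submodule.map_span]
    congr 1
    ext S
    constructor
    · rintro ⟨_, ⟨κ, μ, ρ, σ, x, y, hν, hτ, hx, hxρ, hy, hyσ, rfl⟩, rfl⟩
      exact ⟨κ, μ, θ₂ ρ, θ₂ σ, θ x, θ y, hν, by rw [← map_add, hτ],
        (h.isWeightVector_iff hθ κ x).2 hx, (h.mem_iff ρ x).2 hxρ,
        (h.isWeightVector_iff hθ μ y).2 hy, (h.mem_iff σ y).2 hyσ, h.conj_U x y⟩
    · rintro ⟨κ, μ, ρ, σ, x, y, hν, hτ, hx, hxρ, hy, hyσ, rfl⟩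
      obtain ⟨ρ, rfl⟩ := θ₂.surjective ρ
      obtain ⟨σ, rfl⟩ := θ₂.surjective σ
      obtain ⟨x, rfl⟩ := θ.surjective x
      obtain ⟨y, rfl⟩ := θ.surjective y
      rw [← map_add, θ₂.injective.eq_iff] at hτ
      exact ⟨_, ⟨κ, μ, ρ, σ, x, y, hν, hτ, (h.isWeightVector_iff hθ κ x).1 hx,
        (h.mem_iff ρ x).1 hxρ, (h.isWeightVector_iff hθ μ y).1 hy, (h.mem_iff σ y).1 hyσ, rfl⟩,
        h.conj_U x y⟩
  rw [← key]
  exact Function.Injective.mem_set_image (conjEquiv θ θ₁ h.map_smul).injective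

omit [IsScalarTower F Aᵐᵒᵖ X] [IsScalarTower F A'ᵐᵒᵖ X'] in
/-- A compatible triple maps frames to frames. -/
theorem isFrame (h : IsCompatibleTriple 𝒜 𝒳 ξ 𝒜' 𝒳' ξ' θ θ₁ θ₂) {e : SignedIndex r → X} {v : X}
    (he : IsFrame 𝒳 ξ e v) : IsFrame 𝒳' ξ' (fun p => θ (e p)) (θ v) := by
  have h0 : ∀ x, θ x ∈ 𝒳' 0 ↔ x ∈ 𝒳 0 := fun x => by rw [← h.mem_iff, map_zero]
  refine ⟨fun p => (h0 _).2 (he.mem p), (h0 _).2 he.mem_unit, fun p q => ?_, fun p => ?_, ?_,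
    fun x hx hx' => ?_⟩
  · rw [← h.map_form, he.form, apply_ite θ₁, map_one, map_zero]
  · rw [← h.map_form, he.form_unit, map_zero]
  · rw [← h.map_form, he.form_unit_unit, map_one]
  · obtain ⟨x, rfl⟩ := θ.surjective x
    obtain ⟨c, rfl⟩ := he.exists_eq_smul x ((h0 x).1 hx) fun p => by
      have := hx' p
      rwa [← h.map_form, map_eq_zero_iff θ₁ θ₁.injective] at this
    exact ⟨c, _root_.map_smul θ c v⟩

omit [IsScalarTower F Aᵐᵒᵖ X] in
/-- Composing with an isometry, a compatible triple may be chosen to match given frames. -/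
theorem exists_map_frame (h : IsCompatibleTriple 𝒜 𝒳 ξ 𝒜' 𝒳' ξ' θ θ₁ θ₂)
    (G' : IsGradedForm 𝒜' 𝒳' ξ') {e : SignedIndex r → X} {v : X} (he : IsFrame 𝒳 ξ e v)
    {e' : SignedIndex r → X'} {v' : X'} (he' : IsFrame 𝒳' ξ' e' v') :
    ∃ η : X ≃ₗ[F] X', IsCompatibleTriple 𝒜 𝒳 ξ 𝒜' 𝒳' ξ' η θ₁ θ₂ ∧ ∀ p, η (e p) = e' p := by
  obtain ⟨T, hT, hTξ, hT𝒳⟩ := (h.isFrame he).exists_isometry G' he'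
  refine ⟨θ.trans (T.restrictScalars F), ⟨h.map_star, fun x a => ?_, fun x y => ?_,
    h.map_torus, fun σ => ?_⟩, hT⟩
  · change T (θ _) = _ • T (θ x)
    rw [h.map_smul, _root_.map_smul]
  · change _ = ξ' (T (θ x)) (T (θ y))
    rw [hTξ, h.map_form]
  · ext y
    constructor
    · rintro ⟨x, hx, rfl⟩
      exact (hT𝒳 _ _).2 ((h.mem_iff σ x).2 hx)
    · intro hy
      obtain ⟨x, rfl⟩ := (θ.trans (T.restrictScalars F)).surjective y
      exact ⟨x, (h.mem_iff σ x).1 ((hT𝒳 _ _).1 hy), rfl⟩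

omit [IsScalarTower F Aᵐᵒᵖ X] [IsScalarTower F A'ᵐᵒᵖ X'] in
theorem map_support {L : AddSubgroup Γ} {L' : AddSubgroup Γ'}
    (h : IsCompatibleTriple 𝒜 𝒳 ξ 𝒜' 𝒳' ξ' θ θ₁ θ₂) (T : IsTorusWithInvolution L 𝒜)
    (T' : IsTorusWithInvolution L' 𝒜') : L.map (θ₂ : Γ →+ Γ') = L' := by
  ext τ
  obtain ⟨σ, rfl⟩ := θ₂.surjective τ
  have h1 : θ₂ σ ∈ L.map (θ₂ : Γ →+ Γ') ↔ σ ∈ L :=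
    AddSubgroup.mem_map_iff_mem (f := (θ₂ : Γ →+ Γ')) θ₂.injective
  rw [h1, T.mem_iff_ne_bot, T'.mem_iff_ne_bot, ← h.map_torus, Ne, Ne,
    Submodule.map_eq_bot_iff]

end IsCompatibleTriple

end Transport

/-! ### Extending data on the weight-zero space to a compatible triple -/

section Coordinates

variable {A X : Type*} [Ring A] [StarRing A] [AddCommGroup X] [Module Aᵐᵒᵖ X] {r : ℕ}

/-- The orthogonal complement of the family `e`. When `e` is the hyperbolic part of a frame, it
is the space of weight-zero vectors. -/
def weightZero (ξ : HermitianForm A X) (e : SignedIndex r → X) : Submodule Aᵐᵒᵖ X where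
  carrier := {x | ∀ p, ξ (e p) x = 0}
  add_mem' hx hy p := by rw [ξ.add_right, hx, hy, add_zero]
  zero_mem' p := ξ.zero_right _
  smul_mem' c x hx p := by
    induction c using MulOpposite.rec' with
    | h a => rw [ξ.smul_right, hx, zero_mul]

variable {F Γ : Type*} [Field F] [AddCommGroup Γ] [Algebra F A] [Module F X]
  {𝒜 : Γ → Submodule F A} {𝒳 : Γ → Submodule F X} {ξ : HermitianForm A X}
  {e : SignedIndex r → X} {v : X}

namespace IsFrame

omit [Algebra F A] in
theorem perpPart_mem_weightZero (h : IsFrame 𝒳 ξ e v) (x : X) :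
    perpPart ξ opp e x ∈ weightZero ξ e := fun p => h.isSelfDual.form_perpPart p x

omit [Algebra F A] in
theorem unit_mem_weightZero (h : IsFrame 𝒳 ξ e v) : v ∈ weightZero ξ e := h.form_unit

variable [IsScalarTower F Aᵐᵒᵖ X]

/-- The coordinates of a vector along the hyperbolic vectors of a frame, and its weight-zero
part. -/
def coords (h : IsFrame 𝒳 ξ e v) : X ≃ₗ[F] (SignedIndex r → A) × weightZero ξ e where
  toFun x := (fun p => ξ (e p.opp) x, ⟨perpPart ξ opp e x, h.perpPart_mem_weightZero x⟩)
  map_add' x y := by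
    refine Prod.ext (funext fun p => ξ.add_right _ x y) (Subtype.ext (map_add _ x y))
  map_smul' c x := by
    refine Prod.ext (funext fun p => ξ.form_smul_right c _ x) (Subtype.ext ?_)
    exact ((perpPart ξ opp e).restrictScalars F).map_smul c x
  invFun y := ∑ p, e p <• y.1 p + y.2
  left_inv x := by
    simp only [perpPart_apply]
    abel
  right_inv y := by
    refine Prod.ext (funext fun p => ?_) (Subtype.ext ?_)
    · change ξ _ (_ + _) = _
      rw [ξ.add_right, h.isSelfDual.form_sum, y.2.2 p.opp, add_zero, opp_opp]
    · change perpPart ξ opp e (_ + _) = _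
      rw [map_add, h.isSelfDual.perpPart_sum, zero_add, perpPart_eq_self y.2.2]

/-- Homogeneity is read off from the coordinates. -/
theorem mem_iff_coords (G : IsGradedForm 𝒜 𝒳 ξ) (h : IsFrame 𝒳 ξ e v) (σ : Γ) (x : X) :
    x ∈ 𝒳 σ ↔ (∀ p, (h.coords x).1 p ∈ 𝒜 σ) ∧ ((h.coords x).2 : X) ∈ 𝒳 σ := by
  constructor
  · intro hx
    exact ⟨fun p => zero_add σ ▸ G.form_mem (h.mem p.opp) hx, perpPart_mem G h.mem hx⟩
  · rintro ⟨h1, h2⟩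
    rw [← h.coords.symm_apply_apply x]
    refine Submodule.add_mem _ (Submodule.sum_mem _ fun p _ => ?_) h2
    simpa using G.smul_mem (h.mem p) (h1 p)

end IsFrame

variable [IsScalarTower F Aᵐᵒᵖ X]
  {Γ' A' X' : Type*} [AddCommGroup Γ'] [Ring A'] [StarRing A'] [Algebra F A']
  [AddCommGroup X'] [Module F X'] [Module A'ᵐᵒᵖ X'] [IsScalarTower F A'ᵐᵒᵖ X']
  {𝒜' : Γ' → Submodule F A'} {𝒳' : Γ' → Submodule F X'} {ξ' : HermitianForm A' X'}
  {e' : SignedIndex r → X'} {v' : X'}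

/-- A semilinear isometry between the weight-zero spaces extends to a compatible triple. Since
`ξ(v, v.α) = α` for the unit vector `v`, the linear map `ϑ` on the coordinate algebras is
automatically multiplicative and commutes with the involutions. -/
theorem exists_compatibleTriple (G : IsGradedForm 𝒜 𝒳 ξ) (G' : IsGradedForm 𝒜' 𝒳' ξ')
    (h : IsFrame 𝒳 ξ e v) (h' : IsFrame 𝒳' ξ' e' v') (θ₂ : Γ ≃+ Γ') (ϑ : A ≃ₗ[F] A')
    (φ : weightZero ξ e ≃ₗ[F] weightZero ξ' e')
    (hϑ : ∀ σ α, ϑ α ∈ 𝒜' (θ₂ σ) ↔ α ∈ 𝒜 σ)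
    (hφ : ∀ σ w, (φ w : X') ∈ 𝒳' (θ₂ σ) ↔ (w : X) ∈ 𝒳 σ)
    (hsmul : ∀ w α, φ (w <• α) = φ w <• ϑ α)
    (hform : ∀ w w' : weightZero ξ e, ϑ (ξ w w') = ξ' (φ w) (φ w'))
    (hunit : (φ ⟨v, h.unit_mem_weightZero⟩ : X') = v') :
    ∃ (θ : X ≃ₗ[F] X') (θ₁ : A ≃ₐ[F] A'),
      IsCompatibleTriple 𝒜 𝒳 ξ 𝒜' 𝒳' ξ' θ θ₁ θ₂ := by
  set u : weightZero ξ e := ⟨v, h.unit_mem_weightZero⟩ with hu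
  have hu' : ∀ α, (φ (u <• α) : X') = v' <• ϑ α := fun α => by
    rw [hsmul, ← hunit]
    rfl
  have hα : ∀ α, ξ (u : X) ((u <• α : weightZero ξ e) : X) = α := fun α => by
    change ξ v (v <• α) = α
    rw [ξ.smul_right, h.form_unit_unit, one_mul]
  have hone : ϑ 1 = 1 := by
    have h1 := hform u u
    rw [hunit, h'.form_unit_unit] at h1
    rwa [show ξ (u : X) (u : X) = 1 from h.form_unit_unit] at h1
  have hmul : ∀ α β, ϑ (α * β) = ϑ α * ϑ β := fun α β => by
    have h1 := hform u (u <• (α * β))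
    have h2 : (φ (u <• (α * β)) : X') = v' <• ϑ α <• ϑ β := by
      rw [MulOpposite.op_mul, mul_smul, hsmul, ← hu' α]
      rfl
    rw [hα, h2, hunit, ξ'.smul_right, ξ'.smul_right, h'.form_unit_unit, one_mul] at h1
    exact h1
  have hstar : ∀ α, ϑ (star α) = star (ϑ α) := fun α => by
    have h1 := hform (u <• α) u
    rw [hu', hunit, ξ'.smul_left, h'.form_unit_unit, mul_one, ξ.symm, hα] at h1
    exact h1
  let θ : X ≃ₗ[F] X' := h.coords.trans
    ((LinearEquiv.prodCongr (LinearEquiv.piCongrRight fun _ => ϑ) φ).trans h'.coords.symm)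
  have hcoords : ∀ x, h'.coords (θ x) = (fun p => ϑ ((h.coords x).1 p), φ (h.coords x).2) :=
    fun x => h'.coords.apply_symm_apply _
  have hco : ∀ x p, ξ' (e' p) (θ x) = ϑ (ξ (e p) x) := fun x p => by
    simpa [IsFrame.coords] using congrFun (congrArg Prod.fst (hcoords x)) p.opp
  have hperp : ∀ x, perpPart ξ' opp e' (θ x) = φ (h.coords x).2 := fun x =>
    congrArg (fun y => (y.2 : X')) (hcoords x)
  refine ⟨θ, AlgEquiv.ofLinearEquiv ϑ hone hmul, ⟨hstar, fun x α => ?_, fun x y => ?_,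
    fun σ => ?_, fun σ => ?_⟩⟩
  · apply h'.coords.injective
    refine Prod.ext (funext fun p => ?_) (Subtype.ext ?_)
    · change ξ' (e' p.opp) (θ (x <• α)) = ξ' (e' p.opp) (θ x <• ϑ α)
      rw [hco, ξ'.smul_right, hco, ξ.smul_right, hmul]
    · change perpPart ξ' opp e' (θ (x <• α)) = perpPart ξ' opp e' (θ x <• ϑ α)
      rw [LinearMap.map_smul, hperp, hperp]
      have h1 : (h.coords (x <• α)).2 = (h.coords x).2 <• α :=
        Subtype.ext (map_smul (perpPart ξ opp e) _ x)
      rw [h1, hsmul]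
      rfl
  · change ϑ (ξ x y) = _
    rw [h.isSelfDual.form_eq x y, h'.isSelfDual.form_eq (θ x), hperp, hperp, map_add, map_sum]
    congr 1
    · refine Finset.sum_congr rfl fun p _ => ?_
      rw [hmul, ξ'.symm (e' _), hco, hco, ← hstar, ← ξ.symm]
    · exact hform (h.coords x).2 (h.coords y).2
  · ext α
    constructor
    · rintro ⟨β, hβ, rfl⟩
      exact (hϑ σ β).2 hβ
    · intro hα
      obtain ⟨β, rfl⟩ := ϑ.surjective α
      exact ⟨β, (hϑ σ β).1 hα, rfl⟩
  · have hmem : ∀ x, θ x ∈ 𝒳' (θ₂ σ) ↔ x ∈ 𝒳 σ := fun x => by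
      rw [h'.mem_iff_coords G', h.mem_iff_coords G, hcoords]
      simp only [hϑ, hφ]
    ext y
    constructor
    · rintro ⟨x, hx, rfl⟩
      exact (hmem x).2 hx
    · intro hy
      obtain ⟨x, rfl⟩ := θ.surjective y
      exact ⟨x, (hmem x).1 hy, rfl⟩

end Coordinates

/-! ### Root spaces of the special unitary Lie algebra -/

section RootSpaces

variable {F Γ A X : Type*} [Field F] [AddCommGroup Γ] [Ring A] [StarRing A]
  [Algebra F A] [AddCommGroup X] [Module F X] [Module Aᵐᵒᵖ X] [IsScalarTower F Aᵐᵒᵖ X]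
  {L : AddSubgroup Γ} {𝒜 : Γ → Submodule F A} {𝒳 : Γ → Submodule F X}
  {ξ : HermitianForm A X}

/-- The linear map `y ↦ U(x, y)`. -/
def HermitianForm.Uₗ (hstar : ∀ (c : F) (a : A), star (c • a) = c • star a)
    (ξ : HermitianForm A X) (x : X) : X →ₗ[F] Module.End Aᵐᵒᵖ X where
  toFun := ξ.U x
  map_add' := ξ.U_add_right x
  map_smul' c y := ξ.U_fsmul_right hstar c x y

/-- The linear map `α ↦ x.α`. -/
def orbitMap (F : Type*) {A X : Type*} [Field F] [Ring A] [Algebra F A] [AddCommGroup X]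
    [Module F X] [Module Aᵐᵒᵖ X] [IsScalarTower F Aᵐᵒᵖ X] (x : X) : A →ₗ[F] X where
  toFun α := x <• α
  map_add' α β := by rw [MulOpposite.op_add, add_smul]
  map_smul' c α := by rw [MulOpposite.op_smul, smul_assoc, RingHom.id_apply]

theorem HermitianForm.lie_U_mem (ξ : HermitianForm A X) (x y z w : X) :
    ⁅ξ.U x y, ξ.U z w⁆ ∈ ξ.specialUnitary F :=
  Submodule.subset_span ⟨_, Submodule.subset_span ⟨x, y, rfl⟩, _,
    Submodule.subset_span ⟨z, w, rfl⟩, rfl⟩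

variable {r : ℕ} {v : X}

namespace IsFrame

section Brackets

variable {e : SignedIndex r → X}

omit [Algebra F A] [IsScalarTower F Aᵐᵒᵖ X] in
/-- The vector `y` is recovered from `U(e_p, y)` by evaluation at `e_{-p}`. -/
theorem U_apply_opp (h : IsFrame 𝒳 ξ e v) (p : SignedIndex r) {y : X}
    (hy : ξ (e p.opp) y = 0) : ξ.U (e p) y (e p.opp) = -y := by
  rw [ξ.U_apply, ξ.eq_zero_symm hy, h.form_self_opp]
  simp

omit [Algebra F A] [IsScalarTower F Aᵐᵒᵖ X] in
theorem eq_of_U_eq (h : IsFrame 𝒳 ξ e v) (p : SignedIndex r) {y z : X}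
    (hy : ξ (e p.opp) y = 0) (hz : ξ (e p.opp) z = 0) (hU : ξ.U (e p) y = ξ.U (e p) z) :
    y = z := by
  rw [← neg_inj, ← h.U_apply_opp p hy, ← h.U_apply_opp p hz, hU]

omit [Algebra F A] [IsScalarTower F Aᵐᵒᵖ X] in
theorem form_opp_smul (h : IsFrame 𝒳 ξ e v) {p q : SignedIndex r} (hpq : p.1 ≠ q.1) (α : A) :
    ξ (e p.opp) (e q <• α) = 0 := by
  rw [ξ.smul_right, h.form_fst_ne (p := p.opp) hpq, zero_mul]

omit [Algebra F A] [IsScalarTower F Aᵐᵒᵖ X] in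
theorem smul_injective (h : IsFrame 𝒳 ξ e v) (q : SignedIndex r) {α β : A}
    (hαβ : e q <• α = e q <• β) : α = β := by
  have := congrArg (ξ (e q.opp)) hαβ
  simpa only [ξ.smul_right, h.form_opp, one_mul] using this

omit [Algebra F A] [IsScalarTower F Aᵐᵒᵖ X] in
theorem lie_long_short (h : IsFrame 𝒳 ξ e v) {p q : SignedIndex r} (hpq : p.1 ≠ q.1) (α : A)
    {w : X} (hw : w ∈ weightZero ξ e) :
    ⁅ξ.U (e p) (e q <• α), ξ.U (e q.opp) w⁆ = ξ.U (e p) (w <• α) := by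
  have h1 : ξ.U (e p) (e q <• α) (e q.opp) = e p <• star α := by
    rw [ξ.U_apply, ξ.smul_left, h.form_self_opp, h.form_fst_ne (q := q.opp) hpq]
    simp
  have h2 : ξ.U (e p) (e q <• α) w = 0 := by
    rw [ξ.U_apply, ξ.smul_left, hw p, hw q]
    simp
  rw [ξ.lie_U, h1, h2, ξ.U_zero_right, add_zero, ξ.U_smul_left, star_star]

omit [Algebra F A] [IsScalarTower F Aᵐᵒᵖ X] in
theorem lie_short_short (h : IsFrame 𝒳 ξ e v) {p q : SignedIndex r} (hpq : p.1 ≠ q.1)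
    {w w' : X} (hw : w ∈ weightZero ξ e) (hw' : w' ∈ weightZero ξ e) :
    ⁅ξ.U (e p) w, ξ.U (e q) w'⁆ = -ξ.U (e p) (e q <• ξ w' w) := by
  have h1 : ξ.U (e p) w (e q) = 0 := by
    rw [ξ.U_apply, ξ.eq_zero_symm (hw q), h.form_fst_ne hpq]
    simp
  have h2 : ξ.U (e p) w w' = e p <• ξ w w' := by
    rw [ξ.U_apply, hw' p]
    simp
  rw [ξ.lie_U, h1, h2, ξ.U_zero_left, zero_add, ξ.U_swap, ξ.U_smul_left, ← ξ.symm]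

/-- Since `ξ(v, v.α) = α`, the operator `U(e_p, e_q.α)` is `-[U(e_p, v.α), U(e_q, v)]`. -/
theorem U_long_mem (h : IsFrame 𝒳 ξ e v) {p q : SignedIndex r} (hpq : p.1 ≠ q.1) (α : A) :
    ξ.U (e p) (e q <• α) ∈ ξ.specialUnitary F := by
  have hv := h.unit_mem_weightZero
  have h1 := h.lie_short_short hpq ((weightZero ξ e).smul_mem (MulOpposite.op α) hv) hv
  rw [ξ.smul_right, h.form_unit_unit, one_mul] at h1
  rw [← neg_neg (ξ.U (e p) _), ← h1]
  exact (ξ.specialUnitary F).neg_mem (ξ.lie_U_mem _ _ _ _)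

/-- The operator `U(e_p, w)` is `[U(e_p, e_q), U(e_{-q}, w)]`. -/
theorem U_short_mem (h : IsFrame 𝒳 ξ e v) {p q : SignedIndex r} (hpq : p.1 ≠ q.1) {w : X}
    (hw : w ∈ weightZero ξ e) : ξ.U (e p) w ∈ ξ.specialUnitary F := by
  have h1 := h.lie_long_short hpq 1 hw
  rw [MulOpposite.op_one, one_smul, one_smul] at h1
  rw [← h1]
  exact ξ.lie_U_mem _ _ _ _

/-- The element `U(e_p, e_q.α)` of the special unitary Lie algebra. -/
def longVec (h : IsFrame 𝒳 ξ e v) {p q : SignedIndex r} (hpq : p.1 ≠ q.1) (α : A) :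
    ξ.specialUnitary F :=
  ⟨ξ.U (e p) (e q <• α), h.U_long_mem hpq α⟩

/-- The element `U(e_p, w)`, `w` of weight zero, of the special unitary Lie algebra. The index `q`
only serves to show that it is a commutator. -/
def shortVec (h : IsFrame 𝒳 ξ e v) {p q : SignedIndex r} (hpq : p.1 ≠ q.1)
    (w : weightZero ξ e) : ξ.specialUnitary F :=
  ⟨ξ.U (e p) w, h.U_short_mem hpq w.2⟩

end Brackets

variable [CharZero F] {K : Type*} {b : Module.Basis (Fin (2 * r) ⊕ K) Aᵐᵒᵖ X}

local notation "ε" => frameOfBasis b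

omit [Algebra F A] [IsScalarTower F Aᵐᵒᵖ X] [CharZero F] in
theorem isWeightVector_frame (h : IsFrame 𝒳 ξ ε v) (p : SignedIndex r) :
    IsWeightVector F ξ b p.wt (ε p) := by
  simpa using h.isWeightVector_smul p 1

/-- The long root space `𝓢_{±ε_i±ε_j}` is a copy of `A`. -/
theorem component_long (T : IsTorusWithInvolution L 𝒜) (G : IsGradedForm 𝒜 𝒳 ξ)
    (h : IsFrame 𝒳 ξ ε v) {p q : SignedIndex r} (hpq : p.1 ≠ q.1) (τ : Γ) :
    component 𝒳 ξ b (p.wt + q.wt) τ =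
      (𝒜 τ).map (ξ.Uₗ T.star_smul (ε p) ∘ₗ orbitMap F (ε q)) := by
  apply le_antisymm
  · rw [component, Submodule.span_le]
    rintro _ ⟨κ, μ, ρ, σ, x, y, hν, rfl, hx, hxρ, hy, hyσ, rfl⟩
    rcases eq_or_ne x 0 with rfl | hx0
    · rw [ξ.U_zero_left]
      exact Submodule.zero_mem _
    rcases eq_or_ne y 0 with rfl | hy0
    · rw [ξ.U_zero_right]
      exact Submodule.zero_mem _
    rcases eq_or_ne κ 0 with rfl | hκ
    · exfalso
      rw [zero_add] at hν
      obtain ⟨c, rfl, -⟩ := h.isWeightVector_cases hy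
        (hν ▸ wt_add_wt_ne_zero hpq) hy0
      exact wt_ne_wt_add_wt hpq hν
    rcases eq_or_ne μ 0 with rfl | hμ
    · exfalso
      rw [add_zero] at hν
      obtain ⟨c, rfl, -⟩ := h.isWeightVector_cases hx hκ hx0
      exact wt_ne_wt_add_wt hpq hν
    obtain ⟨a, rfl, hxa⟩ := h.isWeightVector_cases hx hκ hx0
    obtain ⟨c, rfl, hyc⟩ := h.isWeightVector_cases hy hμ hy0
    have hα : ξ (ε a.opp) x ∈ 𝒜 ρ := by simpa using G.form_mem (h.mem a.opp) hxρ
    have hβ : ξ (ε c.opp) y ∈ 𝒜 σ := by simpa using G.form_mem (h.mem c.opp) hyσ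
    rcases wt_add_wt_eq hpq hν with ⟨rfl, rfl⟩ | ⟨rfl, rfl⟩
    · refine ⟨ξ (ε c.opp) y * star (ξ (ε a.opp) x), ?_, ?_⟩
      · rw [add_comm]
        exact T.mul_mem hβ (T.star_mem hα)
      · change ξ.U (ε a) (ε c <• (_ : A)) = _
        rw [MulOpposite.op_mul, mul_smul, ← hyc, ← ξ.U_smul_left, ← hxa]
    · refine ⟨-(ξ (ε a.opp) x * star (ξ (ε c.opp) y)),
        Submodule.neg_mem _ (T.mul_mem hα (T.star_mem hβ)), ?_⟩
      rw [map_neg]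
      change -ξ.U (ε c) (ε a <• (_ : A)) = _
      rw [MulOpposite.op_mul, mul_smul, ← hxa, ← ξ.U_smul_left, ← hyc, ξ.U_swap, neg_neg]
  · rintro _ ⟨α, hα, rfl⟩
    refine Submodule.subset_span ⟨p.wt, q.wt, 0, τ, ε p, ε q <• α, rfl, zero_add τ,
      h.isWeightVector_frame p, h.mem p, h.isWeightVector_smul q α, ?_, rfl⟩
    simpa using G.smul_mem (h.mem q) hα

/-- The short root space `𝓢_{±ε_i}` is a copy of the weight-zero space. -/
theorem component_short (T : IsTorusWithInvolution L 𝒜) (G : IsGradedForm 𝒜 𝒳 ξ)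
    (h : IsFrame 𝒳 ξ ε v) (p : SignedIndex r) (τ : Γ) :
    component 𝒳 ξ b p.wt τ = ((weightZero ξ ε).restrictScalars F ⊓ 𝒳 τ).map
      (ξ.Uₗ T.star_smul (ε p)) := by
  -- `U(e_p.α, y) = U(e_p, y.ᾱ)` for a weight vector `e_p.α` and a weight-zero vector `y`
  have key : ∀ {ρ σ : Γ} {x y : X}, IsWeightVector F ξ b p.wt x → x ≠ 0 → x ∈ 𝒳 ρ →
      IsWeightVector F ξ b 0 y → y ∈ 𝒳 σ →
      ξ.U x y ∈ ((weightZero ξ ε).restrictScalars F ⊓ 𝒳 (σ + ρ)).map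
        (ξ.Uₗ T.star_smul (ε p)) := by
    intro ρ σ x y hx hx0 hxρ hy hyσ
    obtain ⟨a, ha, hxa⟩ := h.isWeightVector_cases hx p.wt_ne_zero hx0
    obtain rfl := wt_injective ha
    have hα : ξ (ε p.opp) x ∈ 𝒜 ρ := by simpa using G.form_mem (h.mem p.opp) hxρ
    refine ⟨y <• star (ξ (ε p.opp) x), ⟨?_, G.smul_mem hyσ (T.star_mem hα)⟩, ?_⟩
    · exact (weightZero ξ ε).smul_mem _ ((h.isWeightVector_zero_iff y).1 hy)
    · change ξ.U (ε p) (y <• (_ : A)) = _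
      rw [← ξ.U_smul_left, ← hxa]
  apply le_antisymm
  · rw [component, Submodule.span_le]
    rintro _ ⟨κ, μ, ρ, σ, x, y, hν, rfl, hx, hxρ, hy, hyσ, rfl⟩
    rcases eq_or_ne x 0 with rfl | hx0
    · rw [ξ.U_zero_left]
      exact Submodule.zero_mem _
    rcases eq_or_ne y 0 with rfl | hy0
    · rw [ξ.U_zero_right]
      exact Submodule.zero_mem _
    rcases eq_or_ne κ 0 with rfl | hκ
    · rw [zero_add] at hν
      subst hν
      rw [ξ.U_swap]
      exact Submodule.neg_mem _ (key hy hy0 hyσ hx hxρ)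
    rcases eq_or_ne μ 0 with rfl | hμ
    · rw [add_zero] at hν
      subst hν
      rw [add_comm ρ σ]
      exact key hx hx0 hxρ hy hyσ
    obtain ⟨a, rfl, -⟩ := h.isWeightVector_cases hx hκ hx0
    obtain ⟨c, rfl, -⟩ := h.isWeightVector_cases hy hμ hy0
    exfalso
    by_cases hac : a.1 = c.1
    · rcases eq_or_eq_opp hac with rfl | rfl
      · exact wt_add_self_ne _ _ hν
      · rw [wt_opp, neg_add_cancel] at hν
        exact p.wt_ne_zero hν.symm
    · exact wt_ne_wt_add_wt hac hν.symm
  · rintro _ ⟨w, ⟨hw, hwτ⟩, rfl⟩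
    exact Submodule.subset_span ⟨p.wt, 0, 0, τ, ε p, w, add_zero _, zero_add τ,
      h.isWeightVector_frame p, h.mem p, (h.isWeightVector_zero_iff w).2 hw, hwτ, rfl⟩

end IsFrame

end RootSpaces

/-! ### Bi-isomorphisms preserve short roots -/

section Roots

variable {F Γ A X : Type*} [Field F] [AddCommGroup Γ] [Ring A] [StarRing A]
  [Algebra F A] [AddCommGroup X] [Module F X] [Module Aᵐᵒᵖ X] [IsScalarTower F Aᵐᵒᵖ X]
  {L : AddSubgroup Γ} {𝒜 : Γ → Submodule F A} {𝒳 : Γ → Submodule F X}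
  {ξ : HermitianForm A X} {r : ℕ} {K : Type*} {b : Module.Basis (Fin (2 * r) ⊕ K) Aᵐᵒᵖ X}
  {v : X}

/-- `ν` lies in the support of the grading of the special unitary Lie algebra by the root
lattice. -/
def IsRoot (𝒳 : Γ → Submodule F X) (ξ : HermitianForm A X)
    (b : Module.Basis (Fin (2 * r) ⊕ K) Aᵐᵒᵖ X) (ν : RootLattice r) : Prop :=
  ∃ τ, specialUnitaryGrading 𝒳 ξ b ν τ ≠ ⊥

theorem isRoot_of_mem {ν : RootLattice r} {τ : Γ} {T : Module.End Aᵐᵒᵖ X}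
    (hT : T ∈ ξ.specialUnitary F) (hν : T ∈ component 𝒳 ξ b ν τ) (h0 : T ≠ 0) :
    IsRoot 𝒳 ξ b ν :=
  ⟨τ, (Submodule.ne_bot_iff _).2 ⟨⟨T, hT⟩, hν, fun h => h0 (congrArg Subtype.val h)⟩⟩

local notation "ε" => frameOfBasis b

namespace IsFrame

variable [CharZero F]

theorem isRoot_cases (h : IsFrame 𝒳 ξ ε v) {ν : RootLattice r} (hν : IsRoot 𝒳 ξ b ν) :
    ν = 0 ∨ (∃ p : SignedIndex r, ν = p.wt) ∨ ∃ p q : SignedIndex r, ν = p.wt + q.wt := by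
  obtain ⟨τ, hτ⟩ := hν
  obtain ⟨⟨T, hT⟩, hTν, hT0⟩ := (Submodule.ne_bot_iff _).1 hτ
  by_contra hne
  have hbot : component 𝒳 ξ b ν τ ≤ ⊥ := by
    rw [component, Submodule.span_le]
    rintro _ ⟨κ, μ, ρ, σ, x, y, rfl, rfl, hx, hxρ, hy, hyσ, rfl⟩
    rw [SetLike.mem_coe, Submodule.mem_bot]
    by_contra hU
    have hx0 : x ≠ 0 := by
      rintro rfl
      exact hU (ξ.U_zero_left y)
    have hy0 : y ≠ 0 := by
      rintro rfl
      exact hU (ξ.U_zero_right x)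
    apply hne
    rcases eq_or_ne κ 0 with rfl | hκ
    · rcases eq_or_ne μ 0 with rfl | hμ
      · exact Or.inl (add_zero 0)
      · obtain ⟨c, rfl, -⟩ := h.isWeightVector_cases hy hμ hy0
        exact Or.inr (Or.inl ⟨c, zero_add _⟩)
    · obtain ⟨a, rfl, -⟩ := h.isWeightVector_cases hx hκ hx0
      rcases eq_or_ne μ 0 with rfl | hμ
      · exact Or.inr (Or.inl ⟨a, add_zero _⟩)
      · obtain ⟨c, rfl, -⟩ := h.isWeightVector_cases hy hμ hy0
        exact Or.inr (Or.inr ⟨a, c, rfl⟩)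
  exact hT0 (Subtype.ext ((Submodule.mem_bot F).1 (hbot hTν)))

/-- Roots have `ℓ¹`-norm at most `2`. -/
theorem sum_abs_le_two (h : IsFrame 𝒳 ξ ε v) {ν : RootLattice r} (hν : IsRoot 𝒳 ξ b ν) :
    ∑ i, |ν i| ≤ 2 := by
  rcases h.isRoot_cases hν with rfl | ⟨p, rfl⟩ | ⟨p, q, rfl⟩
  · simp
  · rw [sum_abs_wt]
    norm_num
  · calc ∑ i, |(p.wt + q.wt) i| ≤ ∑ i, (|p.wt i| + |q.wt i|) :=
        Finset.sum_le_sum fun i _ => abs_add_le _ _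
      _ = 2 := by rw [Finset.sum_add_distrib, sum_abs_wt, sum_abs_wt]; norm_num

theorem isRoot_wt (T : IsTorusWithInvolution L 𝒜) (G : IsGradedForm 𝒜 𝒳 ξ)
    (h : IsFrame 𝒳 ξ ε v) {p q : SignedIndex r} (hpq : p.1 ≠ q.1) : IsRoot 𝒳 ξ b p.wt := by
  have := T.nontrivial
  refine isRoot_of_mem (τ := 0) (h.U_short_mem hpq h.unit_mem_weightZero) ?_ fun h0 => ?_
  · rw [h.component_short T G]
    exact ⟨v, ⟨h.unit_mem_weightZero, h.mem_unit⟩, rfl⟩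
  · have hv := h.eq_of_U_eq p (h.form_unit p.opp) (ξ.zero_right _)
      (h0.trans (ξ.U_zero_right _).symm)
    have h1 := h.form_unit_unit
    rw [hv, ξ.zero_left] at h1
    exact zero_ne_one h1

theorem isRoot_wt_add_wt (T : IsTorusWithInvolution L 𝒜) (G : IsGradedForm 𝒜 𝒳 ξ)
    (h : IsFrame 𝒳 ξ ε v) {p q : SignedIndex r} (hpq : p.1 ≠ q.1) :
    IsRoot 𝒳 ξ b (p.wt + q.wt) := by
  have := T.nontrivial
  refine isRoot_of_mem (τ := 0) (h.U_long_mem hpq 1) ?_ fun h0 => ?_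
  · rw [h.component_long T G hpq]
    exact ⟨1, T.one_mem, rfl⟩
  · have hv := h.eq_of_U_eq p (h.form_opp_smul hpq 1) (ξ.zero_right _)
      (h0.trans (ξ.U_zero_right _).symm)
    have h1 : ε q <• (1 : A) = ε q <• (0 : A) := by
      rw [hv, MulOpposite.op_zero, zero_smul]
    exact one_ne_zero (h.smul_injective q h1)

variable {Γ' A' X' : Type*} [AddCommGroup Γ'] [Ring A'] [StarRing A'] [Algebra F A']
  [AddCommGroup X'] [Module F X'] [Module A'ᵐᵒᵖ X'] [IsScalarTower F A'ᵐᵒᵖ X']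
  {L' : AddSubgroup Γ'} {𝒜' : Γ' → Submodule F A'} {𝒳' : Γ' → Submodule F X'}
  {ξ' : HermitianForm A' X'} {K' : Type*} {b' : Module.Basis (Fin (2 * r) ⊕ K') A'ᵐᵒᵖ X'}
  {v' : X'}

/-- An isomorphism of root lattices that preserves the supports maps short roots to short roots:
a long root is a sum of two nonzero vectors whose difference is a root or zero, whereas a short
root is not. -/
theorem exists_map_wt (T : IsTorusWithInvolution L 𝒜) (G : IsGradedForm 𝒜 𝒳 ξ)
    (h : IsFrame 𝒳 ξ ε v) (T' : IsTorusWithInvolution L' 𝒜') (G' : IsGradedForm 𝒜' 𝒳' ξ')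
    (h' : IsFrame 𝒳' ξ' (frameOfBasis b') v') (ψr : RootLattice r ≃+ RootLattice r)
    (hψ : ∀ ν, IsRoot 𝒳' ξ' b' (ψr ν) ↔ IsRoot 𝒳 ξ b ν) {p q : SignedIndex r}
    (hpq : p.1 ≠ q.1) : ∃ p' : SignedIndex r, ψr p.wt = p'.wt := by
  have hnot : ∀ β γ : RootLattice r, β + γ = ψr p.wt →
      β - γ = 0 ∨ IsRoot 𝒳' ξ' b' (β - γ) → β = 0 ∨ γ = 0 := by
    intro β γ hsum hdiff
    obtain ⟨β, rfl⟩ := ψr.surjective β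
    obtain ⟨γ, rfl⟩ := ψr.surjective γ
    rw [← map_add, ψr.injective.eq_iff] at hsum
    rw [← map_sub, hψ, map_eq_zero_iff ψr ψr.injective] at hdiff
    rw [map_eq_zero_iff ψr ψr.injective, map_eq_zero_iff ψr ψr.injective]
    refine eq_zero_or_eq_zero_of_sum_abs_le hsum ?_
    rcases hdiff with h0 | h0
    · rw [h0]
      simp
    · exact h.sum_abs_le_two h0
  have hne : ψr p.wt ≠ 0 := by
    rw [Ne, map_eq_zero_iff ψr ψr.injective]
    exact p.wt_ne_zero
  rcases h'.isRoot_cases ((hψ _).2 (h.isRoot_wt T G hpq)) with h0 | hp' | ⟨a, c, hac⟩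
  · exact absurd h0 hne
  · exact hp'
  · exfalso
    have hdiff : a.wt - c.wt = 0 ∨ IsRoot 𝒳' ξ' b' (a.wt - c.wt) := by
      by_cases hfst : a.1 = c.1
      · rcases eq_or_eq_opp hfst with rfl | rfl
        · exact Or.inl (sub_self _)
        · rw [wt_opp, neg_add_cancel] at hac
          exact absurd hac hne
      · rw [sub_eq_add_neg, ← wt_opp]
        exact Or.inr (h'.isRoot_wt_add_wt T' G' hfst)
    rcases hnot _ _ hac.symm hdiff with h0 | h0
    · exact a.wt_ne_zero h0
    · exact c.wt_ne_zero h0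

end IsFrame

end Roots

/-! ### Reconstruction of the form from the Lie algebra -/

section Reconstruction

/-- An isomorphism between subalgebras `S` and `S'` that matches families `C`, `C'` of subspaces,
which are the images of the components of graded spaces `D`, `D'` under injective linear maps `j`,
`j'`, induces a graded isomorphism between `D` and `D'`. -/
theorem exists_equiv_of_graded {F Γ Γ' 𝓔 𝓔' D D' : Type*} [Field F] [AddCommGroup Γ]
    [AddCommGroup Γ'] [LieRing 𝓔] [LieAlgebra F 𝓔] [LieRing 𝓔'] [LieAlgebra F 𝓔']
    [AddCommGroup D] [Module F D] [AddCommGroup D'] [Module F D']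
    {S : LieSubalgebra F 𝓔} {S' : LieSubalgebra F 𝓔'} (ψ : S ≃ₗ⁅F⁆ S') (ψe : Γ ≃+ Γ')
    {C : Γ → Submodule F 𝓔} {C' : Γ' → Submodule F 𝓔'}
    (hψ : ∀ σ s, (ψ s : 𝓔') ∈ C' (ψe σ) ↔ (s : 𝓔) ∈ C σ)
    (j : D →ₗ[F] 𝓔) (hj : Function.Injective j) (hjS : ∀ d, j d ∈ S)
    (j' : D' →ₗ[F] 𝓔') (hj' : Function.Injective j') (hjS' : ∀ d, j' d ∈ S')
    {𝒟 : Γ → Submodule F D} {𝒟' : Γ' → Submodule F D'} (h𝒟 : ⨆ σ, 𝒟 σ = ⊤)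
    (h𝒟' : ⨆ σ, 𝒟' σ = ⊤) (hC : ∀ σ, C σ = (𝒟 σ).map j) (hC' : ∀ σ, C' σ = (𝒟' σ).map j') :
    ∃ t : D ≃ₗ[F] D', (∀ d, (ψ ⟨j d, hjS d⟩ : 𝓔') = j' (t d)) ∧
      ∀ σ d, t d ∈ 𝒟' (ψe σ) ↔ d ∈ 𝒟 σ := by
  let P : D →ₗ[F] 𝓔' :=
    { toFun := fun d => (ψ ⟨j d, hjS d⟩ : 𝓔')
      map_add' := fun d d' => by
        have : (⟨j (d + d'), hjS _⟩ : S) = ⟨j d, hjS d⟩ + ⟨j d', hjS d'⟩ :=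
          Subtype.ext (map_add j d d')
        rw [this, map_add]
        rfl
      map_smul' := fun c d => by
        have : (⟨j (c • d), hjS _⟩ : S) = c • ⟨j d, hjS d⟩ := Subtype.ext (map_smul j c d)
        rw [this, map_smul]
        rfl }
  have hP : Function.Injective P := fun d d' hdd => by
    have h1 := ψ.injective (Subtype.ext hdd)
    exact hj (congrArg Subtype.val h1)
  have hmap : ∀ σ, (𝒟 σ).map P = (𝒟' (ψe σ)).map j' := by
    intro σ
    rw [← hC']
    ext y
    constructor
    · rintro ⟨d, hd, rfl⟩
      exact (hψ σ _).2 (by rw [hC]; exact ⟨d, hd, rfl⟩)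
    · intro hy
      have hyS : y ∈ S' := by
        rw [hC'] at hy
        obtain ⟨d, -, rfl⟩ := hy
        exact hjS' d
      obtain ⟨s, hs⟩ : ∃ s, ψ s = ⟨y, hyS⟩ := ψ.surjective _
      have hsC : (s : 𝓔) ∈ C σ := (hψ σ s).1 (by rwa [hs])
      rw [hC] at hsC
      obtain ⟨d, hd, hds⟩ := hsC
      refine ⟨d, hd, ?_⟩
      change (ψ ⟨j d, hjS d⟩ : 𝓔') = y
      rw [show (⟨j d, hjS d⟩ : S) = s from Subtype.ext hds, hs]
  have hrange : LinearMap.range P = LinearMap.range j' := by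
    rw [LinearMap.range_eq_map, LinearMap.range_eq_map, ← h𝒟, ← h𝒟', Submodule.map_iSup,
      Submodule.map_iSup, ← ψe.surjective.iSup_comp]
    exact iSup_congr hmap
  let t : D ≃ₗ[F] D' := (LinearEquiv.ofInjective P hP).trans
    ((LinearEquiv.ofEq _ _ hrange).trans (LinearEquiv.ofInjective j' hj').symm)
  have ht : ∀ d, j' (t d) = P d := fun d =>
    congrArg Subtype.val ((LinearEquiv.ofInjective j' hj').apply_symm_apply _)
  refine ⟨t, fun d => (ht d).symm, fun σ d => ?_⟩
  have h1 : P d ∈ (𝒟 σ).map P ↔ d ∈ 𝒟 σ := Function.Injective.mem_set_image hP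
  have h2 : j' (t d) ∈ (𝒟' (ψe σ)).map j' ↔ t d ∈ 𝒟' (ψe σ) :=
    Function.Injective.mem_set_image hj'
  rw [← h1, ← h2, ht, hmap]

variable {F Γ A X : Type*} [Field F] [CharZero F] [AddCommGroup Γ] [Ring A] [StarRing A]
  [Algebra F A] [AddCommGroup X] [Module F X] [Module Aᵐᵒᵖ X] [IsScalarTower F Aᵐᵒᵖ X]
  {L : AddSubgroup Γ} {𝒜 : Γ → Submodule F A} {𝒳 : Γ → Submodule F X}
  {ξ : HermitianForm A X} {r : ℕ} {K : Type*} {b : Module.Basis (Fin (2 * r) ⊕ K) Aᵐᵒᵖ X}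
  {v : X}
  {Γ' A' X' : Type*} [AddCommGroup Γ'] [Ring A'] [StarRing A'] [Algebra F A']
  [AddCommGroup X'] [Module F X'] [Module A'ᵐᵒᵖ X'] [IsScalarTower F A'ᵐᵒᵖ X']
  {L' : AddSubgroup Γ'} {𝒜' : Γ' → Submodule F A'} {𝒳' : Γ' → Submodule F X'}
  {ξ' : HermitianForm A' X'} {K' : Type*} {b' : Module.Basis (Fin (2 * r) ⊕ K') A'ᵐᵒᵖ X'}
  {v' : X'}

local notation "ε" => frameOfBasis b
local notation "ε'" => frameOfBasis b'

/-- The homogeneous components of the weight-zero space. -/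
def weightZeroGrading (𝒳 : Γ → Submodule F X) (ξ : HermitianForm A X) (e : SignedIndex r → X)
    (σ : Γ) : Submodule F (weightZero ξ e) :=
  (𝒳 σ).comap ((weightZero ξ e).subtype.restrictScalars F)

omit [CharZero F] in
theorem iSup_weightZeroGrading (G : IsGradedForm 𝒜 𝒳 ξ) {e : SignedIndex r → X}
    (h : IsFrame 𝒳 ξ e v) : ⨆ σ, weightZeroGrading 𝒳 ξ e σ = ⊤ := by
  classical
  let π : X →ₗ[F] weightZero ξ e :=
    ((perpPart ξ opp e).codRestrict _ h.perpPart_mem_weightZero).restrictScalars F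
  have hπ : ∀ σ, (𝒳 σ).map π ≤ weightZeroGrading 𝒳 ξ e σ := by
    rintro σ _ ⟨x, hx, rfl⟩
    exact perpPart_mem G h.mem hx
  have hsurj : LinearMap.range π = ⊤ :=
    LinearMap.range_eq_top.2 fun w => ⟨w, Subtype.ext (perpPart_eq_self w.2)⟩
  rw [eq_top_iff, ← hsurj, LinearMap.range_eq_map, ← G.isInternal.submodule_iSup_eq_top,
    Submodule.map_iSup]
  exact iSup_mono hπ

section Restriction

variable (T : IsTorusWithInvolution L 𝒜) (G : IsGradedForm 𝒜 𝒳 ξ)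
  (h : IsFrame 𝒳 ξ (frameOfBasis b) v) (T' : IsTorusWithInvolution L' 𝒜')
  (G' : IsGradedForm 𝒜' 𝒳' ξ') (h' : IsFrame 𝒳' ξ' (frameOfBasis b') v')
  (ψ : ξ.specialUnitary F ≃ₗ⁅F⁆ ξ'.specialUnitary F) (ψe : Γ ≃+ Γ')
  {p q p' q' : SignedIndex r} (hpq : p.1 ≠ q.1) (hpq' : p'.1 ≠ q'.1)

include T T' G G' h h' hpq hpq'

/-- The isomorphism of coordinate algebras, as vector spaces, induced on a long root space. -/
theorem exists_long_equiv (hψ : ∀ σ s, (ψ s : Module.End A'ᵐᵒᵖ X') ∈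
      component 𝒳' ξ' b' (p'.wt + q'.wt) (ψe σ) ↔
        (s : Module.End Aᵐᵒᵖ X) ∈ component 𝒳 ξ b (p.wt + q.wt) σ) :
    ∃ t : A ≃ₗ[F] A', (∀ α, (ψ (h.longVec hpq α) :
      Module.End A'ᵐᵒᵖ X') = ξ'.U (ε' p') (ε' q' <• t α)) ∧
      ∀ σ α, t α ∈ 𝒜' (ψe σ) ↔ α ∈ 𝒜 σ := by
  classical
  have hinj : Function.Injective (ξ.Uₗ T.star_smul (ε p) ∘ₗ orbitMap F (A := A) (ε q)) :=
    fun α β hαβ => h.smul_injective q (h.eq_of_U_eq p (y := ε q <• α) (z := ε q <• β)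
      (h.form_opp_smul hpq _) (h.form_opp_smul hpq _) hαβ)
  have hinj' : Function.Injective (ξ'.Uₗ T'.star_smul (ε' p') ∘ₗ orbitMap F (A := A') (ε' q')) :=
    fun α β hαβ => h'.smul_injective q' (h'.eq_of_U_eq p' (y := ε' q' <• α) (z := ε' q' <• β)
      (h'.form_opp_smul hpq' _) (h'.form_opp_smul hpq' _) hαβ)
  exact exists_equiv_of_graded ψ ψe hψ _ hinj (h.U_long_mem hpq) _ hinj' (h'.U_long_mem hpq')
    T.isInternal.submodule_iSup_eq_top T'.isInternal.submodule_iSup_eq_top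
    (h.component_long T G hpq) (h'.component_long T' G' hpq')

/-- The isomorphism of weight-zero spaces, as vector spaces, induced on a short root space. -/
theorem exists_short_equiv (hψ : ∀ σ s, (ψ s : Module.End A'ᵐᵒᵖ X') ∈
      component 𝒳' ξ' b' p'.wt (ψe σ) ↔
        (s : Module.End Aᵐᵒᵖ X) ∈ component 𝒳 ξ b p.wt σ) :
    ∃ t : weightZero ξ ε ≃ₗ[F] weightZero ξ' ε',
      (∀ w : weightZero ξ ε, (ψ (h.shortVec hpq w) :
        Module.End A'ᵐᵒᵖ X') = ξ'.U (ε' p') (t w)) ∧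
      ∀ σ w, (t w : X') ∈ 𝒳' (ψe σ) ↔ (w : X) ∈ 𝒳 σ := by
  have hC : ∀ σ, component 𝒳 ξ b p.wt σ = (weightZeroGrading 𝒳 ξ ε σ).map
      (ξ.Uₗ T.star_smul (ε p) ∘ₗ (weightZero ξ ε).subtype.restrictScalars F) := by
    intro σ
    rw [h.component_short T G, Submodule.map_comp]
    congr 1
    ext x
    exact ⟨fun hx => ⟨⟨x, hx.1⟩, hx.2, rfl⟩, by rintro ⟨w, hw, rfl⟩; exact ⟨w.2, hw⟩⟩
  have hC' : ∀ σ, component 𝒳' ξ' b' p'.wt σ = (weightZeroGrading 𝒳' ξ' ε' σ).map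
      (ξ'.Uₗ T'.star_smul (ε' p') ∘ₗ (weightZero ξ' ε').subtype.restrictScalars F) := by
    intro σ
    rw [h'.component_short T' G', Submodule.map_comp]
    congr 1
    ext x
    exact ⟨fun hx => ⟨⟨x, hx.1⟩, hx.2, rfl⟩, by rintro ⟨w, hw, rfl⟩; exact ⟨w.2, hw⟩⟩
  have hinj : Function.Injective
      (ξ.Uₗ T.star_smul (ε p) ∘ₗ (weightZero ξ ε).subtype.restrictScalars F) :=
    fun w w' hw => Subtype.ext (h.eq_of_U_eq p (w.2 _) (w'.2 _) hw)
  have hinj' : Function.Injective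
      (ξ'.Uₗ T'.star_smul (ε' p') ∘ₗ (weightZero ξ' ε').subtype.restrictScalars F) :=
    fun w w' hw => Subtype.ext (h'.eq_of_U_eq p' (w.2 _) (w'.2 _) hw)
  exact exists_equiv_of_graded ψ ψe hψ _ hinj (fun w => h.U_short_mem hpq w.2) _ hinj'
    (fun w => h'.U_short_mem hpq' w.2)
    (iSup_weightZeroGrading G h) (iSup_weightZeroGrading G' h') hC hC'

end Restriction

/-- If two special unitary Lie algebras of rank at least two are bi-isomorphic, then there is a
compatible triple between their hermitian forms. -/
theorem exists_triple_of_biIsomorphic (T : IsTorusWithInvolution L 𝒜)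
    (G : IsGradedForm 𝒜 𝒳 ξ) (h : IsFrame 𝒳 ξ ε v) (T' : IsTorusWithInvolution L' 𝒜')
    (G' : IsGradedForm 𝒜' 𝒳' ξ') (h' : IsFrame 𝒳' ξ' ε' v') (hr : 2 ≤ r)
    (hbi : BiIsomorphic (specialUnitaryGrading 𝒳 ξ b) (specialUnitaryGrading 𝒳' ξ' b')) :
    ∃ (θ : X ≃ₗ[F] X') (θ₁ : A ≃ₐ[F] A') (θ₂ : Γ ≃+ Γ'),
      IsCompatibleTriple 𝒜 𝒳 ξ 𝒜' 𝒳' ξ' θ θ₁ θ₂ := by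
  have := T.nontrivial
  have := T'.nontrivial
  obtain ⟨ψ, ψr, ψe, hψ⟩ := hbi
  have hcomp : ∀ ν σ s, (ψ s : Module.End A'ᵐᵒᵖ X') ∈ component 𝒳' ξ' b' (ψr ν) (ψe σ) ↔
      (s : Module.End Aᵐᵒᵖ X) ∈ component 𝒳 ξ b ν σ := by
    intro ν σ s
    change ψ s ∈ specialUnitaryGrading 𝒳' ξ' b' (ψr ν) (ψe σ) ↔
      s ∈ specialUnitaryGrading 𝒳 ξ b ν σ
    rw [← hψ]
    exact Function.Injective.mem_set_image ψ.injective
  have hroot : ∀ ν, IsRoot 𝒳' ξ' b' (ψr ν) ↔ IsRoot 𝒳 ξ b ν := by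
    intro ν
    rw [IsRoot, IsRoot, ψe.surjective.exists]
    refine exists_congr fun σ => not_congr ?_
    rw [← hψ]
    exact Submodule.map_eq_bot_iff
  let p : SignedIndex r := (⟨0, by omega⟩, 1)
  let q : SignedIndex r := (⟨1, by omega⟩, 1)
  have hpq : p.1 ≠ q.1 := by simp [p, q]
  obtain ⟨p', hp'⟩ := h.exists_map_wt T G T' G' h' ψr hroot hpq
  obtain ⟨q', hq'⟩ := h.exists_map_wt T G T' G' h' ψr hroot hpq.symm
  have hnq' : ψr q.opp.wt = q'.opp.wt := by rw [wt_opp, map_neg, hq', wt_opp]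
  have hpq' : p'.1 ≠ q'.1 := by
    intro hfst
    rcases eq_or_eq_opp hfst with rfl | rfl
    · exact ne_of_fst_ne hpq (wt_injective (ψr.injective (hp'.trans hq'.symm)))
    · exact ne_of_fst_ne (q := q.opp) hpq (wt_injective (ψr.injective (hp'.trans hnq'.symm)))
  have hlong : ∀ {a c a' c' : SignedIndex r}, ψr a.wt = a'.wt → ψr c.wt = c'.wt →
      ∀ σ s, (ψ s : Module.End A'ᵐᵒᵖ X') ∈ component 𝒳' ξ' b' (a'.wt + c'.wt) (ψe σ) ↔
        (s : Module.End Aᵐᵒᵖ X) ∈ component 𝒳 ξ b (a.wt + c.wt) σ := by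
    intro a c a' c' ha hc σ s
    rw [← ha, ← hc, ← map_add]
    exact hcomp _ σ s
  -- the maps induced on the root spaces of `p`, `q`, `-q`, `p + q` and `p - q`
  obtain ⟨φp, hφp, hφp𝒳⟩ := exists_short_equiv T G h T' G' h' ψ ψe hpq hpq'
    (hp' ▸ hcomp p.wt)
  obtain ⟨φq, hφq, hφq𝒳⟩ := exists_short_equiv T G h T' G' h' ψ ψe hpq.symm hpq'.symm
    (hq' ▸ hcomp q.wt)
  obtain ⟨φn, hφn, -⟩ := exists_short_equiv T G h T' G' h' ψ ψe (p := q.opp) (p' := q'.opp)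
    hpq.symm hpq'.symm (hnq' ▸ hcomp q.opp.wt)
  obtain ⟨ϑ, hϑ, hϑ𝒜⟩ := exists_long_equiv T G h T' G' h' ψ ψe hpq hpq' (hlong hp' hq')
  obtain ⟨η, hη, hη𝒜⟩ := exists_long_equiv T G h T' G' h' ψ ψe (q := q.opp) (q' := q'.opp)
    hpq hpq' (hlong hp' hnq')
  -- compare the brackets of the elements `U(e_p, e_q.α)`, `U(e_p, e_{-q}.α)` and `U(e_p, w)`
  -- with those of their images
  have hR1 : ∀ (w : weightZero ξ ε) α, φp (w <• α) = φn w <• ϑ α := by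
    intro w α
    have h1 : h.shortVec hpq (w <• α) =
        ⁅h.longVec hpq α, h.shortVec (p := q.opp) hpq.symm w⁆ :=
      Subtype.ext (h.lie_long_short hpq α w.2).symm
    have h2 := hφp (w <• α)
    rw [h1, LieEquiv.map_lie, LieSubalgebra.coe_bracket, hϑ, hφn,
      h'.lie_long_short hpq' _ (φn w).2] at h2
    exact Subtype.ext (h'.eq_of_U_eq p' ((φp (w <• α)).2 _) ((φn w <• ϑ α).2 _) h2.symm)
  have hR2 : ∀ (w : weightZero ξ ε) α, φp (w <• α) = φq w <• η α := by
    intro w α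
    have h1 : h.shortVec hpq (w <• α) =
        ⁅h.longVec (q := q.opp) hpq α, h.shortVec hpq.symm w⁆ :=
      Subtype.ext (h.lie_long_short (q := q.opp) hpq α w.2).symm
    have h2 := hφp (w <• α)
    have h3 := h'.lie_long_short (q := q'.opp) hpq' (η α) (φq w).2
    rw [opp_opp] at h3
    rw [h1, LieEquiv.map_lie, LieSubalgebra.coe_bracket, hη, hφq, h3] at h2
    exact Subtype.ext (h'.eq_of_U_eq p' ((φp (w <• α)).2 _) ((φq w <• η α).2 _) h2.symm)
  have hR3 : ∀ w w' : weightZero ξ ε, ϑ (ξ w' w) = ξ' (φq w') (φp w) := by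
    intro w w'
    have h1 : h.longVec hpq (ξ w' w) = -⁅h.shortVec hpq w, h.shortVec hpq.symm w'⁆ :=
      Subtype.ext ((neg_neg _).symm.trans (congrArg Neg.neg
        (h.lie_short_short hpq w.2 w'.2).symm))
    have h2 := hϑ (ξ w' w)
    rw [h1, map_neg, LieEquiv.map_lie, NegMemClass.coe_neg, LieSubalgebra.coe_bracket, hφp,
      hφq, h'.lie_short_short hpq' (φp w).2 (φq w').2, neg_neg] at h2
    exact h'.smul_injective q' (h'.eq_of_U_eq p' (h'.form_opp_smul hpq' _)
      (h'.form_opp_smul hpq' _) h2).symm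
  -- the degree-zero parts of these root spaces are one-dimensional, which yields scalars
  let u : weightZero ξ ε := ⟨v, h.unit_mem_weightZero⟩
  let u' : weightZero ξ' ε' := ⟨v', h'.unit_mem_weightZero⟩
  have hzero : ∀ w : weightZero ξ' ε', (w : X') ∈ 𝒳' 0 → ∃ t : F, w = t • u' := by
    intro w hw
    obtain ⟨t, ht⟩ := h'.exists_eq_smul w hw w.2
    exact ⟨t, Subtype.ext ht⟩
  obtain ⟨t, ht⟩ := hzero (φp u) (by rw [← map_zero ψe, hφp𝒳]; exact h.mem_unit)
  obtain ⟨s, hs⟩ := hzero (φq u) (by rw [← map_zero ψe, hφq𝒳]; exact h.mem_unit)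
  obtain ⟨c, hc⟩ := T'.exists_eq_smul_one
    (show ϑ 1 ∈ 𝒜' 0 by rw [← map_zero ψe, hϑ𝒜]; exact T.one_mem)
  obtain ⟨d, hd⟩ := T'.exists_eq_smul_one
    (show η 1 ∈ 𝒜' 0 by rw [← map_zero ψe, hη𝒜]; exact T.one_mem)
  have hscal : ∀ (k : F) (w : weightZero ξ' ε'), w <• (k • (1 : A')) = k • w := by
    intro k w
    rw [MulOpposite.op_smul, smul_assoc, MulOpposite.op_one, one_smul]
  have hpn : ∀ w, φp w = c • φn w := by
    intro w
    have h1 := hR1 w 1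
    rwa [hc, hscal, MulOpposite.op_one, one_smul] at h1
  have hpq_eq : ∀ w, φp w = d • φq w := by
    intro w
    have h1 := hR2 w 1
    rwa [hd, hscal, MulOpposite.op_one, one_smul] at h1
  have hu0 : u ≠ 0 := by
    intro h0
    have h1 := h.form_unit_unit
    rw [show v = 0 from congrArg Subtype.val h0, ξ.zero_left] at h1
    exact zero_ne_one h1
  have hu0' : u' ≠ 0 := by
    intro h0
    have h1 := h'.form_unit_unit
    rw [show v' = 0 from congrArg Subtype.val h0, ξ'.zero_left] at h1
    exact zero_ne_one h1
  have ht0 : t ≠ 0 := by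
    rintro rfl
    rw [zero_smul] at ht
    exact hu0 (φp.injective (ht.trans (map_zero φp).symm))
  have hc0 : c ≠ 0 := by
    rintro rfl
    rw [zero_smul] at hc
    exact one_ne_zero (ϑ.injective (hc.trans (map_zero ϑ).symm))
  have hd0 : d ≠ 0 := by
    rintro rfl
    rw [zero_smul] at hd
    exact one_ne_zero (η.injective (hd.trans (map_zero η).symm))
  have htds : t = d * s := by
    have h1 := hpq_eq u
    rw [ht, hs, smul_smul] at h1
    exact smul_left_injective F hu0' h1
  have hcst : c = s * t := by
    have h1 := hR3 u u
    have h2 : ξ (u : X) (u : X) = 1 := h.form_unit_unit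
    have h3 : ξ' (u' : X') (u' : X') = 1 := h'.form_unit_unit
    rw [h2, hc, hs, ht] at h1
    change _ = ξ' (s • (u' : X')) (t • (u' : X')) at h1
    rw [HermitianForm.form_smul_left T'.star_smul, HermitianForm.form_smul_right, h3,
      smul_smul] at h1
    exact smul_left_injective F one_ne_zero h1
  -- this identity makes the rescaled maps `c⁻¹ ϑ` and `t⁻¹ φp` compatible with the forms
  have hcd : c * d = t * t := by rw [hcst, htds]; ring
  suffices hex : ∃ (θ : X ≃ₗ[F] X') (θ₁ : A ≃ₐ[F] A'),
      IsCompatibleTriple 𝒜 𝒳 ξ 𝒜' 𝒳' ξ' θ θ₁ ψe by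
    obtain ⟨θ, θ₁, hθ⟩ := hex
    exact ⟨θ, θ₁, ψe, hθ⟩
  refine exists_compatibleTriple G G' h h' ψe
    (ϑ.trans (LinearEquiv.smulOfNeZero F A' c⁻¹ (inv_ne_zero hc0)))
    (φp.trans (LinearEquiv.smulOfNeZero F _ t⁻¹ (inv_ne_zero ht0))) ?_ ?_ ?_ ?_ ?_
  · intro σ α
    rw [← hϑ𝒜]
    exact Submodule.smul_mem_iff _ (inv_ne_zero hc0)
  · intro σ w
    rw [← hφp𝒳]
    exact Submodule.smul_mem_iff (𝒳' (ψe σ)) (inv_ne_zero ht0)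
  · intro w α
    change t⁻¹ • φp (w <• α) = (t⁻¹ • φp w) <• (c⁻¹ • ϑ α)
    rw [hR1, hpn w, MulOpposite.op_smul, smul_assoc, smul_comm (MulOpposite.op (ϑ α)) t⁻¹,
      smul_comm (MulOpposite.op (ϑ α)) c, smul_comm c⁻¹ t⁻¹, smul_smul c⁻¹ c,
      inv_mul_cancel₀ hc0, one_smul]
  · intro w w'
    have h1 : φq w = d⁻¹ • φp w := by rw [hpq_eq, smul_smul, inv_mul_cancel₀ hd0, one_smul]
    change c⁻¹ • ϑ (ξ w w') = ξ' (t⁻¹ • (φp w : X')) (t⁻¹ • (φp w' : X'))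
    rw [hR3, h1]
    change c⁻¹ • ξ' (d⁻¹ • (φp w : X')) _ = _
    rw [HermitianForm.form_smul_left T'.star_smul, HermitianForm.form_smul_left T'.star_smul,
      HermitianForm.form_smul_right, smul_smul, smul_smul, ← mul_inv, ← mul_inv, hcd]
  · change ((t⁻¹ • φp u : weightZero ξ' ε') : X') = v'
    rw [ht, smul_smul, inv_mul_cancel₀ ht0, one_smul]

end Reconstruction

end UnitaryLieTorus

end

theorem theorem5p6p1 {F : Type*} [Field F] [CharZero F] (r : ℕ)
    {Γ A X K : Type*} [AddCommGroup Γ] [Ring A] [StarRing A] [Algebra F A]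
    [AddCommGroup X] [Module F X] [Module Aᵐᵒᵖ X] [IsScalarTower F Aᵐᵒᵖ X]
    (L : AddSubgroup Γ) (𝒜 : Γ → Submodule F A) (𝒳 : Γ → Submodule F X)
    (ξ : UnitaryLieTorus.HermitianForm A X)
    (hξ : UnitaryLieTorus.IsUnitaryTorusData r L 𝒜 𝒳 ξ)
    (b : Module.Basis (Fin (2 * r) ⊕ K) Aᵐᵒᵖ X)
    (hb : UnitaryLieTorus.IsCompatibleBasis 𝒜 𝒳 ξ b)
    {Γ' A' X' K' : Type*} [AddCommGroup Γ'] [Ring A'] [StarRing A'] [Algebra F A']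
    [AddCommGroup X'] [Module F X'] [Module A'ᵐᵒᵖ X'] [IsScalarTower F A'ᵐᵒᵖ X']
    (L' : AddSubgroup Γ') (𝒜' : Γ' → Submodule F A') (𝒳' : Γ' → Submodule F X')
    (ξ' : UnitaryLieTorus.HermitianForm A' X')
    (hξ' : UnitaryLieTorus.IsUnitaryTorusData r L' 𝒜' 𝒳' ξ')
    (b' : Module.Basis (Fin (2 * r) ⊕ K') A'ᵐᵒᵖ X')
    (hb' : UnitaryLieTorus.IsCompatibleBasis 𝒜' 𝒳' ξ' b') :
    (∀ (θ : X ≃ₗ[F] X') (θ₁ : A ≃ₐ[F] A') (θ₂ : Γ ≃+ Γ'),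
      UnitaryLieTorus.IsCompatibleTriple 𝒜 𝒳 ξ 𝒜' 𝒳' ξ' θ θ₁ θ₂ →
        L.map (θ₂ : Γ →+ Γ') = L' ∧
        UnitaryLieTorus.BiIsomorphic (UnitaryLieTorus.finiteUnitaryGrading 𝒳 ξ b)
          (UnitaryLieTorus.finiteUnitaryGrading 𝒳' ξ' b') ∧
        UnitaryLieTorus.BiIsomorphic (UnitaryLieTorus.specialUnitaryGrading 𝒳 ξ b)
          (UnitaryLieTorus.specialUnitaryGrading 𝒳' ξ' b')) ∧
    (3 ≤ r →
      UnitaryLieTorus.BiIsomorphic (UnitaryLieTorus.specialUnitaryGrading 𝒳 ξ b)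
        (UnitaryLieTorus.specialUnitaryGrading 𝒳' ξ' b') →
      ∃ (θ : X ≃ₗ[F] X') (θ₁ : A ≃ₐ[F] A') (θ₂ : Γ ≃+ Γ'),
        UnitaryLieTorus.IsCompatibleTriple 𝒜 𝒳 ξ 𝒜' 𝒳' ξ' θ θ₁ θ₂) := by
  obtain ⟨v, hv⟩ := hb.exists_isFrame hξ
  obtain ⟨v', hv'⟩ := hb'.exists_isFrame hξ'
  refine ⟨fun θ θ₁ θ₂ h => ?_, fun hr hbi => ?_⟩
  · obtain ⟨η, hη, hηe⟩ := h.exists_map_frame hξ'.graded hv hv'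
    exact ⟨h.map_support hξ.torus hξ'.torus,
      UnitaryLieTorus.BiIsomorphic.of_subalgebras _ θ₂ _ _ hη.map_finiteUnitary _ _
        (hη.conj_mem_component_iff hηe),
      UnitaryLieTorus.BiIsomorphic.of_subalgebras _ θ₂ _ _ hη.map_specialUnitary _ _
        (hη.conj_mem_component_iff hηe)⟩
  · exact UnitaryLieTorus.exists_triple_of_biIsomorphic hξ.torus hξ.graded hv hξ'.torus
      hξ'.graded hv' (by omega) hbi
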